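/- **Setting.** Let $h=\{h_k:k\ge 0\}$ be an offspring distribution with $\sum_k k h_k<1$ and, for some $a>0$, $\sum_{l\ge k}h_l\le e^{-ak}$ for all $k$. Let $\nu$ be a probability measure supported in $[q,Q]\subset(1,\infty)$. If $h_1=0$, assume moreover that $\nu$ is not a point mass. Let $T$ be a Galton-Watson tree with offspring distribution $h$ and root $\phi$, ordered in the usual (Ulam-Harris) way, whose edges carry independent biases of law $\nu$; write $\mathbb P_{h,\nu}$ for its law. For $v\in V(T)$ let $\omega(v)$ be the product of the biases of the edges on the path from $\phi$ to $v$, and let $\omega(T)=\sum_{v\in V(T)}\omega(v)$. **Decomposition.** Let $v_{\max}$ be the lexicographically minimal vertex among those at which $\omega$ is maximal, and let $\kappa=\min\{\ell\ge 1:h_\ell>0\}$. Call a vertex $v$ standard if each strict ancestor $w$ of $v$ has exactly $\kappa$ offspring, the $\kappa-1$ of these that are not on the path from $\phi$ to $v$ have no offspring, and their edges to $w$ have biases strictly smaller than that of the edge from $w$ towards $v$. (If $h_1>0$, then $\kappa=1$, and this says that each strict ancestor of $v$ has exactly one child.) Let $v_{\rm fbp}$ be the last vertex of the initial sequence of standard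 vertices on the path from $\phi$ to $v_{\max}$. The spine $S$ is the path $v_{\rm fbp}=\chi_0,\chi_1,\dots,\chi_s=v_{\max}$, with its biases. For $0\le j<s$, the $j$-th offshoot $O_j$ is the weighted tree, rooted at $\chi_j$, formed by the descendants of $\chi_j$ (including $\chi_j$) that are not descendants of $\chi_{j+1}$ (including $\chi_{j+1}$). The $i$-absent foliage of $T$, where $0\le i<s$, consists of $s$, $S$ and the $O_j$ with $0\le j<s$, $j\ne i$, the offshoots being regarded as unordered weighted rooted trees (that is, up to isomorphism of rooted weighted trees). Let $\mathbb P^{(i)}_{h,\nu}$ denote the regular conditional distribution of $\mathbb P_{h,\nu}$ given the $i$-absent foliage. **Proposition.** There exist $c>0$ and $k_0\in\mathbb N$, depending only on $h$ and $\nu$, such that for every $i\ge 0$ and almost every $i$-absent foliage the following holds for every $u>0$: $\mathbb P^{(i)}_{h,\nu}(\omega(T)>u)>0$ and, for every $k\ge k_0$, $$\mathbb P^{(i)}_{h,\nu}\Big(|V(O_i)|=k\ \Big|\ \omega(T)>u\Big)\le e^{-ck}.$$ -/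

import Mathlib

open MeasureTheory ProbabilityTheory
open scoped ENNReal

noncomputable section

namespace WeightedGW

/-- A finite rooted weighted ordered tree in Ulam-Harris coding. The root is `[]`, the children of a
vertex `u` are the vertices `u ++ [j]`, ordered by `j`, and `bias v` is the bias of the edge joining
`v ≠ []` to its parent `v.dropLast` (the values of `bias` elsewhere are irrelevant). Gaps in the
labels of the children of a vertex are allowed. -/
structure WTree where
  verts : Finset (List ℕ)
  root_mem : [] ∈ verts
  parent_mem : ∀ u j, u ++ [j] ∈ verts → u ∈ verts
  bias : List ℕ → ℝ

namespace WTree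

instance : MeasurableSpace WTree :=
  MeasurableSpace.comap (fun T => (T.verts, T.bias)) inferInstance

/-- The weight of a vertex: the product of the biases along the path from the root to it. -/
def weight (T : WTree) (v : List ℕ) : ℝ :=
  ∏ i ∈ Finset.range v.length, T.bias (v.take (i + 1))

/-- The total weight of the tree: the sum of the weights of its vertices. -/
def totalWeight (T : WTree) : ℝ := ∑ v ∈ T.verts, T.weight v

/-- The offspring of a vertex `u`. -/
def children (T : WTree) (u : List ℕ) : Set (List ℕ) := {w | w ∈ T.verts ∧ ∃ j, w = u ++ [j]}

open Classical in
/-- The vertices of maximal weight. -/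
def maxVerts (T : WTree) : Finset (List ℕ) :=
  T.verts.filter fun v => ∀ w ∈ T.verts, T.weight w ≤ T.weight v

theorem maxVerts_nonempty (T : WTree) : T.maxVerts.Nonempty := by
  obtain ⟨v, hv, h⟩ := T.verts.exists_max_image T.weight ⟨_, T.root_mem⟩
  exact ⟨v, by classical exact Finset.mem_filter.2 ⟨hv, h⟩⟩

/-- The lexicographically minimal vertex among those of maximal weight. -/
def vmax (T : WTree) : List ℕ := T.maxVerts.min' T.maxVerts_nonempty

/-- A vertex `v` is standard if every strict ancestor `u` of `v` has exactly `κ` offspring, all of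
which, except for the one `u ++ [j]` on the path to `v`, are childless and are attached by an edge
of bias strictly smaller than that of the edge from `u` to `u ++ [j]`. For `κ = 1` this says that
every strict ancestor of `v` has exactly one child. -/
def IsStandard (κ : ℕ) (T : WTree) (v : List ℕ) : Prop :=
  ∀ u j, u ++ [j] <+: v → (T.children u).ncard = κ ∧
    ∀ w ∈ T.children u, w ≠ u ++ [j] → T.children w = ∅ ∧ T.bias w < T.bias (u ++ [j])

open Classical in
/-- The depth of the first branch point, which is the last vertex in the initial sequence of
standard vertices on the path from the root to `T.vmax`. -/
def fbpDepth (κ : ℕ) (T : WTree) : ℕ :=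
  Nat.findGreatest (fun n => IsStandard κ T (T.vmax.take n)) T.vmax.length

/-- The number `s` of edges of the spine. -/
def spineLength (κ : ℕ) (T : WTree) : ℕ := T.vmax.length - T.fbpDepth κ

/-- The `j`-th vertex of the spine (for `0 ≤ j ≤ s`): the spine is the path from the first branch
point to `T.vmax`. -/
def spineVertex (κ : ℕ) (T : WTree) (j : ℕ) : List ℕ := T.vmax.take (T.fbpDepth κ + j)

open Classical in
/-- The tree, rooted at `a`, formed by those descendants of `a` that are not descendants of `b`
(for a vertex `a` and one of its children `b`). -/
def branch (T : WTree) (a b : List ℕ) : WTree where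
  verts := insert [] ((T.verts.filter fun v => a <+: v ∧ ¬ b <+: v).image (List.drop a.length))
  root_mem := Finset.mem_insert_self _ _
  parent_mem := by
    intro u j h
    simp only [Finset.mem_insert, List.append_eq_nil_iff, List.cons_ne_self, and_false,
      Finset.mem_image, Finset.mem_filter, false_or] at h ⊢
    obtain ⟨v, ⟨hv, ⟨t, rfl⟩, hb⟩, h⟩ := h
    rw [List.drop_left] at h
    subst h
    rw [← List.append_assoc] at hv hb
    refine Or.inr ⟨a ++ u, ⟨T.parent_mem _ _ hv, List.prefix_append _ _, fun h => hb ?_⟩, ?_⟩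
    · exact h.trans (List.prefix_append _ _)
    · exact List.drop_left
  bias := fun u => T.bias (a ++ u)

/-- The `j`-th offshoot (for `0 ≤ j < s`), rooted at the `j`-th vertex of the spine. -/
def offshoot (κ : ℕ) (T : WTree) (j : ℕ) : WTree :=
  T.branch (T.spineVertex κ j) (T.spineVertex κ (j + 1))

/-- Isomorphism of rooted weighted trees, forgetting the order. -/
def Iso (T T' : WTree) : Prop :=
  ∃ ψ : List ℕ → List ℕ, Set.BijOn ψ T.verts T'.verts ∧ ψ [] = [] ∧
    ∀ v ∈ T.verts, v ≠ [] → ψ v.dropLast = (ψ v).dropLast ∧ T'.bias (ψ v) = T.bias v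

theorem dropLast_mem (T : WTree) {v : List ℕ} (hv : v ∈ T.verts) (h : v ≠ []) :
    v.dropLast ∈ T.verts :=
  T.parent_mem _ (v.getLast h) (by rwa [List.dropLast_append_getLast])

theorem Iso.symm {T T' : WTree} : Iso T T' → Iso T' T := by
  rintro ⟨ψ, hψ, h0, h⟩
  have hinv := hψ.invOn_invFunOn
  have hb : Set.BijOn (Function.invFunOn ψ T.verts) T'.verts T.verts :=
    hinv.symm.bijOn hψ.surjOn.mapsTo_invFunOn hψ.mapsTo
  have h0' : Function.invFunOn ψ T.verts [] = [] := by
    have := hinv.1 (show ([] : List ℕ) ∈ (T.verts : Set (List ℕ)) from T.root_mem)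
    rwa [h0] at this
  refine ⟨_, hb, h0', fun v' hv' hne => ?_⟩
  obtain ⟨v, hv, rfl⟩ := hψ.surjOn hv'
  have hvne : v ≠ [] := by rintro rfl; exact hne h0
  rw [hinv.1 hv, ← (h v hv hvne).1, hinv.1 (T.dropLast_mem hv hvne)]
  exact ⟨rfl, (h v hv hvne).2.symm⟩

instance isoSetoid : Setoid WTree where
  r := Iso
  iseqv :=
    { refl := fun _ => ⟨id, Set.bijOn_id _, rfl, fun _ _ _ => ⟨rfl, rfl⟩⟩
      symm := Iso.symm
      trans := by
        rintro A B C ⟨ψ, hψ, h0, h⟩ ⟨χ, hχ, k0, k⟩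
        refine ⟨χ ∘ ψ, hχ.comp hψ, by simp [h0, k0], fun v hv hne => ?_⟩
        have hψv : ψ v ≠ [] := fun e => hne (hψ.injOn hv A.root_mem (e.trans h0.symm))
        obtain ⟨h1, h2⟩ := h v hv hne
        obtain ⟨k1, k2⟩ := k (ψ v) (hψ.mapsTo hv) hψv
        exact ⟨by simp only [Function.comp_apply, h1, k1], by simp only [Function.comp_apply, k2, h2]⟩ }

end WTree

open WTree

/-- Finite rooted weighted unordered trees, with the quotient σ-algebra. -/
abbrev UTree : Type := Quotient WTree.isoSetoid

/-- The data of an `i`-absent foliage: the length `s` of the spine, the successive biases of the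
edges of the spine, and the unordered offshoots of index `j < s`, `j ≠ i`. -/
abbrev AbsentFoliage (i : ℕ) : Type :=
  Σ s : ℕ, (Fin s → ℝ) × ({j : Fin s // (j : ℕ) ≠ i} → UTree)

/-- The `i`-absent foliage of a tree. -/
def absentFoliage (κ i : ℕ) (T : WTree) : AbsentFoliage i :=
  ⟨T.spineLength κ, fun j => T.bias (T.spineVertex κ (j + 1)), fun j => ⟦T.offshoot κ j⟧⟩

/-! The weighted Galton-Watson law. -/

/-- The vertex set coded by a family of numbers of offspring: the children of `u` are
`u ++ [0], …, u ++ [K u - 1]`. -/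
def gwVerts (K : List ℕ → ℕ) : Set (List ℕ) := {u | ∀ v j, v ++ [j] <+: u → j < K v}

open Classical in
/-- The tree coded by a family of numbers of offspring and biases. It is defined to be the tree with
one vertex in the case, of probability zero for subcritical trees, that the vertex set is infinite. -/
def gwTree (x : List ℕ → ℕ × ℝ) : WTree :=
  if hfin : (gwVerts fun u => (x u).1).Finite then
    { verts := hfin.toFinset
      root_mem := by
        rw [Set.Finite.mem_toFinset]
        intro v j h
        simp at h
      parent_mem := by
        intro u j h
        rw [Set.Finite.mem_toFinset] at h ⊢
        exact fun v k hv => h v k (hv.trans (List.prefix_append _ _))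
      bias := fun u => (x u).2 }
  else
    { verts := {[]}
      root_mem := by simp
      parent_mem := by simp
      bias := fun u => (x u).2 }

/-- The law on weighted trees with offspring law `h` and bias law `ν`: the numbers of offspring and
the biases are all independent, with laws `h` and `ν`. -/
def gwLaw (h : PMF ℕ) (ν : Measure ℝ) : Measure WTree :=
  (Measure.infinitePi fun _ : List ℕ => h.toMeasure.prod ν).map gwTree

namespace WTree

theorem measurable_verts : Measurable WTree.verts :=
  measurable_fst.comp (comap_measurable fun T : WTree => (T.verts, T.bias))

theorem measurable_bias (v : List ℕ) : Measurable fun T : WTree => T.bias v :=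
  (measurable_pi_apply v).comp
    (measurable_snd.comp (comap_measurable fun T : WTree => (T.verts, T.bias)))

theorem measurable_of {α : Type*} [MeasurableSpace α] {f : α → WTree}
    (h1 : Measurable fun x => (f x).verts) (h2 : ∀ v, Measurable fun x => (f x).bias v) :
    Measurable f :=
  measurable_comap_iff.2 (h1.prodMk (measurable_pi_iff.2 h2))

theorem measurableSet_verts (p : Finset (List ℕ) → Prop) :
    MeasurableSet {T : WTree | p T.verts} :=
  measurable_verts (Set.to_countable {V | p V}).measurableSet

theorem measurable_weight (v : List ℕ) : Measurable fun T : WTree => T.weight v :=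
  Finset.measurable_prod _ fun _ _ => measurable_bias _

instance : Nonempty WTree := ⟨⟨{[]}, by simp, by simp, fun _ => 1⟩⟩

instance : StandardBorelSpace WTree := by
  let e : WTree → Finset (List ℕ) × (List ℕ → ℝ) := fun T => (T.verts, T.bias)
  have he : Function.Injective e := by
    rintro ⟨V, _, _, b⟩ ⟨V', _, _, b'⟩ h
    obtain ⟨rfl, rfl⟩ := Prod.mk.inj h
    rfl
  have hr : MeasurableSet (Set.range e) := by
    have : Set.range e =
        {V | [] ∈ V ∧ ∀ u j, u ++ [j] ∈ V → u ∈ V} ×ˢ (Set.univ : Set (List ℕ → ℝ)) := by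
      ext ⟨V, b⟩
      constructor
      · rintro ⟨T, hT⟩
        obtain ⟨rfl, rfl⟩ := Prod.mk.inj hT
        exact ⟨⟨T.root_mem, T.parent_mem⟩, trivial⟩
      · rintro ⟨⟨h1, h2⟩, -⟩
        exact ⟨⟨V, h1, h2, b⟩, rfl⟩
    rw [this]
    exact (Set.to_countable _).measurableSet.prod MeasurableSet.univ
  have hs : StandardBorelSpace (Set.range e) := hr.standardBorel
  obtain ⟨τ, hB, hP⟩ := hs.polish
  let E : WTree ≃ Set.range e := Equiv.ofInjective e he
  let τ' : TopologicalSpace WTree := τ.induced E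
  have hP' : PolishSpace WTree := E.polishSpace_induced
  have hB' : BorelSpace WTree := by
    constructor
    rw [show borel WTree = MeasurableSpace.comap E (@borel _ τ) from borel_comap, ← hB.measurable_eq]
    change MeasurableSpace.comap e _ = MeasurableSpace.comap E (MeasurableSpace.comap Subtype.val _)
    rw [MeasurableSpace.comap_comp]
    rfl
  exact ⟨τ', hB', hP'⟩

theorem measurableSet_mem_maxVerts (v : List ℕ) : MeasurableSet {T : WTree | v ∈ T.maxVerts} := by
  have : {T : WTree | v ∈ T.maxVerts} = {T | v ∈ T.verts} ∩
      ⋂ w : List ℕ, ({T | w ∈ T.verts}ᶜ ∪ {T | T.weight w ≤ T.weight v}) := by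
    ext T
    simp only [maxVerts, Finset.mem_filter, Set.mem_ofPred_eq, Set.mem_inter_iff, Set.mem_iInter,
      Set.mem_union, Set.mem_compl_iff, imp_iff_not_or]
  rw [this]
  exact (measurableSet_verts fun V => v ∈ V).inter <| MeasurableSet.iInter fun w =>
    (measurableSet_verts fun V => w ∈ V).compl.union
      (measurableSet_le (measurable_weight w) (measurable_weight v))

theorem measurableSet_vmax (v : List ℕ) : MeasurableSet {T : WTree | T.vmax = v} := by
  have : {T : WTree | T.vmax = v} = {T | v ∈ T.maxVerts} ∩
      ⋂ w : List ℕ, ({T | w ∈ T.maxVerts}ᶜ ∪ {_T | v ≤ w}) := by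
    ext T
    simp only [Set.mem_ofPred_eq, Set.mem_inter_iff, Set.mem_iInter,
      Set.mem_union, Set.mem_compl_iff, ← imp_iff_not_or]
    constructor
    · rintro rfl
      exact ⟨Finset.min'_mem _ _, fun w hw => Finset.min'_le _ _ hw⟩
    · rintro ⟨h1, h2⟩
      exact le_antisymm (Finset.min'_le _ _ h1) (h2 _ (Finset.min'_mem _ _))
  rw [this]
  exact (measurableSet_mem_maxVerts v).inter <| MeasurableSet.iInter fun w =>
    (measurableSet_mem_maxVerts w).compl.union (MeasurableSet.const _)

theorem measurableSet_isStandard (κ : ℕ) (v : List ℕ) :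
    MeasurableSet {T : WTree | IsStandard κ T v} := by
  have : {T : WTree | IsStandard κ T v} = ⋂ u : List ℕ, ⋂ j : ℕ, ⋂ _ : u ++ [j] <+: v,
      ({T : WTree | (T.children u).ncard = κ} ∩
        ⋂ w : List ℕ, ({T : WTree | w ∈ T.children u}ᶜ ∪ ({_T | w = u ++ [j]} ∪
          ({T | T.children w = ∅} ∩ {T | T.bias w < T.bias (u ++ [j])})))) := by
    ext T
    simp only [IsStandard, Set.mem_ofPred_eq, Set.mem_inter_iff, Set.mem_iInter,
      Set.mem_union, Set.mem_compl_iff, ← imp_iff_not_or, ne_eq, ← or_iff_not_imp_left]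
  rw [this]
  refine MeasurableSet.iInter fun u => MeasurableSet.iInter fun j => MeasurableSet.iInter fun _ => ?_
  refine (measurableSet_verts fun V => {w | w ∈ V ∧ ∃ j, w = u ++ [j]}.ncard = κ).inter
    (MeasurableSet.iInter fun w => ?_)
  refine (measurableSet_verts fun V => w ∈ V ∧ ∃ j, w = u ++ [j]).compl.union
    ((MeasurableSet.const _).union ?_)
  exact (measurableSet_verts fun V => {x | x ∈ V ∧ ∃ j, x = w ++ [j]} = ∅).inter
    (measurableSet_lt (measurable_bias _) (measurable_bias _))

theorem measurableSet_vmax_fbpDepth (κ : ℕ) (v : List ℕ) (d : ℕ) :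
    MeasurableSet {T : WTree | T.vmax = v ∧ T.fbpDepth κ = d} := by
  classical
  have hm : Measurable fun T : WTree =>
      Nat.findGreatest (fun n => IsStandard κ T (v.take n)) v.length :=
    measurable_findGreatest fun k _ => measurableSet_isStandard κ (v.take k)
  have : {T : WTree | T.vmax = v ∧ T.fbpDepth κ = d} = {T | T.vmax = v} ∩
      {T | Nat.findGreatest (fun n => IsStandard κ T (v.take n)) v.length = d} := by
    ext T
    constructor
    · rintro ⟨rfl, h⟩
      refine ⟨rfl, ?_⟩
      rw [fbpDepth] at h
      rw [Set.mem_ofPred_eq, ← h]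
    · rintro ⟨rfl, h⟩
      refine ⟨rfl, ?_⟩
      rw [Set.mem_ofPred_eq] at h
      rw [fbpDepth, ← h]
  rw [this]
  exact (measurableSet_vmax v).inter (hm (measurableSet_singleton d))

theorem measurable_branch (a b : List ℕ) : Measurable fun T : WTree => T.branch a b := by
  classical
  refine measurable_of ?_ fun v => measurable_bias _
  exact (Measurable.of_discrete (f := fun V : Finset (List ℕ) =>
    insert [] ((V.filter fun v => a <+: v ∧ ¬ b <+: v).image (List.drop a.length)))).comp
    measurable_verts

end WTree

theorem measurable_absentFoliage (κ i : ℕ) : Measurable (absentFoliage κ i) := by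
  intro A hA
  let G : List ℕ → ℕ → WTree → AbsentFoliage i := fun v d T =>
    ⟨v.length - d, fun j => T.bias (v.take (d + (j + 1))),
      fun j => ⟦T.branch (v.take (d + j)) (v.take (d + (j + 1)))⟧⟩
  have hG : ∀ v d, Measurable (G v d) := fun v d => by
    have hmk : Measurable (Sigma.mk (β := fun s : ℕ =>
        (Fin s → ℝ) × ({j : Fin s // (j : ℕ) ≠ i} → UTree)) (v.length - d)) :=
      measurable_iff_le_map.2 (iInf_le _ _)
    refine hmk.comp (Measurable.prodMk ?_ ?_)
    · exact measurable_pi_iff.2 fun _ => measurable_bias _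
    · exact measurable_pi_iff.2 fun _ => measurable_quotient_mk''.comp (measurable_branch _ _)
  have : absentFoliage κ i ⁻¹' A = ⋃ v : List ℕ, ⋃ d : ℕ,
      ({T | T.vmax = v ∧ T.fbpDepth κ = d} ∩ G v d ⁻¹' A) := by
    ext T
    simp only [Set.mem_iUnion]
    constructor
    · intro h
      exact ⟨_, _, ⟨rfl, rfl⟩, h⟩
    · rintro ⟨_, _, ⟨rfl, rfl⟩, h⟩
      exact h
  rw [this]
  exact MeasurableSet.iUnion fun v => MeasurableSet.iUnion fun d =>
    (measurableSet_vmax_fbpDepth κ v d).inter (hG v d hA)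

theorem measurable_gwTree : Measurable gwTree := by
  classical
  have hK : Measurable fun x : List ℕ → ℕ × ℝ => gwVerts fun u => (x u).1 := by
    refine measurable_set_iff.2 fun u => ?_
    refine measurableSet_setOfPred.1 ?_
    have : {x : List ℕ → ℕ × ℝ | u ∈ gwVerts fun w => (x w).1} =
        ⋂ v : List ℕ, ⋂ j : ℕ, ⋂ _ : v ++ [j] <+: u, {x | j < (x v).1} := by
      ext x
      simp [gwVerts]
    rw [this]
    exact MeasurableSet.iInter fun v => MeasurableSet.iInter fun j => MeasurableSet.iInter fun _ =>
      measurableSet_lt measurable_const (measurable_fst.comp (measurable_pi_apply v))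
  refine measurable_of ?_ fun v => ?_
  · refine measurable_finset_iff.2 fun a => measurableSet_setOfPred.1 ?_
    have : {x : List ℕ → ℕ × ℝ | a ∈ (gwTree x).verts} =
        ({x | (gwVerts fun u => (x u).1).Finite} ∩ {x | a ∈ gwVerts fun u => (x u).1}) ∪
        ({x | (gwVerts fun u => (x u).1).Finite}ᶜ ∩ {_x | a = []}) := by
      ext x
      by_cases h : (gwVerts fun u => (x u).1).Finite <;> simp [gwTree, h]
    rw [this]
    have hF : MeasurableSet {x : List ℕ → ℕ × ℝ | (gwVerts fun u => (x u).1).Finite} :=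
      hK MeasurableSet.setOfPred_finite
    exact (hF.inter (measurableSet_setOfPred.2 (measurable_set_iff.1 hK a))).union
      (hF.compl.inter (MeasurableSet.const _))
  · have : (fun x => (gwTree x).bias v) = fun x => (x v).2 := by
      funext x
      by_cases h : (gwVerts fun u => (x u).1).Finite <;> simp [gwTree, h]
    rw [this]
    exact measurable_snd.comp (measurable_pi_apply v)

instance (h : PMF ℕ) (ν : Measure ℝ) [IsProbabilityMeasure ν] :
    IsProbabilityMeasure (gwLaw h ν) :=
  Measure.isProbabilityMeasure_map measurable_gwTree.aemeasurable

/-- The least positive number of offspring that has positive probability. -/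
def minOffspring (h : PMF ℕ) : ℕ := sInf {l | 1 ≤ l ∧ h l ≠ 0}

/-- The conditional distribution of the weighted Galton-Watson tree given its `i`-absent foliage. -/
def absentLaw (h : PMF ℕ) (ν : Measure ℝ) [IsProbabilityMeasure ν] (i : ℕ) :
    Kernel (AbsentFoliage i) WTree :=
  condDistrib id (absentFoliage (minOffspring h) i) (gwLaw h ν)

end WeightedGW

end

noncomputable section

namespace WeightedGW

open WTree

/-! ### The vertex set of a Galton-Watson tree -/

/-! Two surgeries leave the `i`-absent foliage unchanged, and the theorem comes from comparing their
costs. Let `A` be any event on the foliage that forces `i < s`.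

Pruning. Suppose that `O_i` has `k` vertices, and cut it down to one of finitely many small shapes.
The vertex of maximal weight survives and no vertex outweighs it, so the total weight drops by a
factor of at most `k`. Subcriticality and the exponential tail give an offshoot of `k` vertices
probability at most `ρ ^ k` with `ρ < 1`, while each shape has positive probability. Hence P(A,
|O_i| = k, ω > u) ≤ C k ρ^k P(A, k ω > u), which is `exists_gwLaw_largeOffshootEvent_le`. If `i =
0`, the shape must prevent the next spine vertex from becoming standard, since otherwise the first
branch point would move; every offshoot with more than `κ` vertices can be cut to such a shape
(`exists_shapes`).

Prolongation. Put a new root above the tree, with `κ` children: the old root and `κ - 1` leaves on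
strictly lighter edges. The new piece is standard, so the spine and all offshoots are unchanged, and
the weight grows by a factor of at least `q`. This costs a constant: p P(A, q ω > u) ≤ P(A, ω > u),
which is `gwLaw_foliageEvent_ge`. For `κ ≥ 2` the strict inequality of biases requires that `ν` is
not a point mass.

Combination. If `q ^ n ≥ k`, then `n` prolongations make up for the weight lost by pruning, at the
price `p ^ (-n)`. A small multiple of `k` suffices for `n`, so this price uses up only part of the
decay of `ρ ^ k` (`exists_exponential_rate`). As `A` is arbitrary, the inequality passes to the
conditional law. Positivity of the conditioning event also comes from prolongation: the weight is at
least `1`, so enough prolongations lift it above `u`. -/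

theorem nil_mem_gwVerts (K : List ℕ → ℕ) : [] ∈ gwVerts K := by
  intro v j h
  simp at h

theorem concat_mem_gwVerts {K : List ℕ → ℕ} {u : List ℕ} {m : ℕ} :
    u ++ [m] ∈ gwVerts K ↔ u ∈ gwVerts K ∧ m < K u := by
  constructor
  · intro h
    exact ⟨fun v j hv => h v j (hv.trans (List.prefix_append _ _)), h u m List.prefix_rfl⟩
  · rintro ⟨h, hm⟩ v j hv
    rcases List.prefix_concat_iff.1 hv with e | e
    · obtain ⟨rfl, e⟩ := List.append_inj' e rfl
      obtain rfl : j = m := by simpa using e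
      exact hm
    · exact h v j e

theorem append_mem_gwVerts {K : List ℕ → ℕ} {a u : List ℕ} :
    a ++ u ∈ gwVerts K ↔ a ∈ gwVerts K ∧ u ∈ gwVerts fun r => K (a ++ r) := by
  induction u using List.reverseRecOn with
  | nil => simp [nil_mem_gwVerts]
  | append_singleton u m ih =>
    rw [← List.append_assoc, concat_mem_gwVerts, concat_mem_gwVerts, ih, and_assoc]

theorem singleton_mem_gwVerts {K : List ℕ → ℕ} {m : ℕ} : [m] ∈ gwVerts K ↔ m < K [] := by
  simpa [nil_mem_gwVerts] using concat_mem_gwVerts (K := K) (u := []) (m := m)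

theorem cons_mem_gwVerts {K : List ℕ → ℕ} {m : ℕ} {u : List ℕ} :
    m :: u ∈ gwVerts K ↔ m < K [] ∧ u ∈ gwVerts fun r => K (m :: r) := by
  have := append_mem_gwVerts (K := K) (a := [m]) (u := u)
  rw [singleton_mem_gwVerts] at this
  simpa using this

theorem WTree.eq_of_verts_of_bias {T T' : WTree} (h : T.verts = T'.verts) (h' : T.bias = T'.bias) :
    T = T' := by
  cases T
  cases T'
  simp_all

/-- The tree coded by separate families of numbers of offspring and of biases. -/
def gw (K : List ℕ → ℕ) (b : List ℕ → ℝ) : WTree := gwTree fun u => (K u, b u)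

theorem gw_bias (K : List ℕ → ℕ) (b : List ℕ → ℝ) : (gw K b).bias = b := by
  by_cases h : (gwVerts K).Finite <;> simp [gw, gwTree, h]

theorem mem_gw_verts {K : List ℕ → ℕ} (hK : (gwVerts K).Finite) {b : List ℕ → ℝ} {u : List ℕ} :
    u ∈ (gw K b).verts ↔ u ∈ gwVerts K := by
  simp [gw, gwTree, hK]

theorem gw_verts_of_infinite {K : List ℕ → ℕ} (hK : ¬ (gwVerts K).Finite) (b : List ℕ → ℝ) :
    (gw K b).verts = {[]} := by
  simp [gw, gwTree, hK]

/-- The numbers of offspring at labels that are not vertices play no role, so they may be altered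
freely. -/
theorem gw_congr {K K' : List ℕ → ℕ} (h : gwVerts K = gwVerts K') (b : List ℕ → ℝ) :
    gw K b = gw K' b := by
  refine WTree.eq_of_verts_of_bias ?_ (by rw [gw_bias, gw_bias])
  by_cases hK : (gwVerts K).Finite
  · ext u
    rw [mem_gw_verts hK, mem_gw_verts (h ▸ hK), h]
  · rw [gw_verts_of_infinite hK, gw_verts_of_infinite (h ▸ hK)]

/-! ### Swapping two children of a vertex -/

/-- The map on labels that exchanges the descendants of the children `0` and `j` of `a`. -/
def swapAt : List ℕ → ℕ → List ℕ → List ℕ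
  | _, _, [] => []
  | [], j, m :: r => Equiv.swap 0 j m :: r
  | x :: a, j, y :: r => if x = y then y :: swapAt a j r else y :: r

@[simp] theorem swapAt_nil_right (a : List ℕ) (j : ℕ) : swapAt a j [] = [] := by
  cases a <;> rfl

@[simp] theorem swapAt_nil_cons (j m : ℕ) (r : List ℕ) :
    swapAt [] j (m :: r) = Equiv.swap 0 j m :: r := rfl

theorem swapAt_swapAt (a : List ℕ) (j : ℕ) (u : List ℕ) : swapAt a j (swapAt a j u) = u := by
  induction a generalizing u with
  | nil => cases u <;> simp
  | cons x a ih =>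
    cases u with
    | nil => simp
    | cons y r => by_cases h : x = y <;> simp [swapAt, h, ih]

theorem swapAt_injective (a : List ℕ) (j : ℕ) : Function.Injective (swapAt a j) :=
  Function.LeftInverse.injective (swapAt_swapAt a j)

@[simp] theorem length_swapAt (a : List ℕ) (j : ℕ) (u : List ℕ) :
    (swapAt a j u).length = u.length := by
  induction a generalizing u with
  | nil => cases u <;> simp
  | cons x a ih =>
    cases u with
    | nil => simp
    | cons y r => by_cases h : x = y <;> simp [swapAt, h, ih]

theorem swapAt_take (a : List ℕ) (j : ℕ) (u : List ℕ) (n : ℕ) :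
    swapAt a j (u.take n) = (swapAt a j u).take n := by
  induction a generalizing u n with
  | nil => cases u <;> cases n <;> simp
  | cons x a ih =>
    cases u with
    | nil => simp
    | cons y r =>
      cases n with
      | zero => simp
      | succ n => by_cases h : x = y <;> simp [swapAt, h, ih]

theorem swapAt_append (a : List ℕ) (j : ℕ) (r : List ℕ) :
    swapAt a j (a ++ r) = a ++ swapAt [] j r := by
  induction a with
  | nil => simp
  | cons x a ih => simp [swapAt, ih]

theorem swapAt_of_not_prefix {a u : List ℕ} (j : ℕ) (h : ¬ a <+: u) : swapAt a j u = u := by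
  induction a generalizing u with
  | nil => simp at h
  | cons x a ih =>
    cases u with
    | nil => simp
    | cons y r =>
      by_cases hxy : x = y
      · subst hxy
        simp only [swapAt, if_true]
        rw [ih (by simpa using h)]
      · simp [swapAt, hxy]

theorem swapAt_self (a : List ℕ) (j : ℕ) : swapAt a j a = a := by
  simpa using swapAt_append a j []

theorem prefix_swapAt_iff {a : List ℕ} {j : ℕ} {u : List ℕ} : a <+: swapAt a j u ↔ a <+: u := by
  constructor <;> intro h
  · by_contra h'
    rw [swapAt_of_not_prefix j h'] at h
    exact h' h
  · obtain ⟨r, rfl⟩ := h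
    rw [swapAt_append]
    exact List.prefix_append _ _

theorem swapAt_prefix {a : List ℕ} {j : ℕ} {u w : List ℕ} (h : u <+: w) :
    swapAt a j u <+: swapAt a j w := by
  rw [List.prefix_iff_eq_take] at h
  rw [h, swapAt_take]
  exact List.take_prefix _ _

theorem swapAt_prefix_iff {a : List ℕ} {j : ℕ} {u w : List ℕ} :
    swapAt a j u <+: swapAt a j w ↔ u <+: w :=
  ⟨fun h => by simpa only [swapAt_swapAt] using swapAt_prefix (a := a) (j := j) h, swapAt_prefix⟩

theorem swapAt_append_zero_cons (a : List ℕ) (j : ℕ) (t : List ℕ) :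
    swapAt a j (a ++ 0 :: t) = a ++ j :: t := by
  simp [swapAt_append]

theorem swapAt_concat {a u : List ℕ} (j m : ℕ) (h : u ≠ a) :
    swapAt a j (u ++ [m]) = swapAt a j u ++ [m] := by
  by_cases ha : a <+: u
  · obtain ⟨r, rfl⟩ := ha
    cases r with
    | nil => simp at h
    | cons x r => rw [List.append_assoc, swapAt_append, swapAt_append]; simp
  · rw [swapAt_of_not_prefix j ha]
    by_cases h' : a <+: u ++ [m]
    · rcases List.prefix_concat_iff.1 h' with e | e
      · rw [← e, swapAt_self]
      · exact absurd e ha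
    · rw [swapAt_of_not_prefix j h']

/-- Since `j < K a`, both `0` and `j` are labels of children of `a`, and the transposition permutes
the labels below `K a`. -/
theorem mem_gwVerts_comp_swapAt {K : List ℕ → ℕ} {a : List ℕ} {j : ℕ} (hj : j < K a)
    {u : List ℕ} : u ∈ gwVerts (K ∘ swapAt a j) ↔ swapAt a j u ∈ gwVerts K := by
  induction u using List.reverseRecOn with
  | nil => simp [nil_mem_gwVerts]
  | append_singleton u m ih =>
    rw [concat_mem_gwVerts, ih]
    by_cases h : u = a
    · subst h
      rw [swapAt_append, swapAt_nil_cons, concat_mem_gwVerts, Function.comp_apply, swapAt_self]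
      refine and_congr_right fun _ => ?_
      rw [Equiv.swap_apply_def]
      split_ifs <;> omega
    · rw [swapAt_concat j m h, concat_mem_gwVerts, Function.comp_apply]

/-! ### The lexicographic order and prefixes -/

theorem list_cons_le_cons_iff {m m' : ℕ} {x y : List ℕ} :
    m :: x ≤ m' :: y ↔ m < m' ∨ m = m' ∧ x ≤ y := by
  rw [← not_lt, List.cons_lt_cons_iff, ← not_lt]
  rcases lt_trichotomy m m' with h | h | h
  · simp [h, h.not_gt, h.ne']
  · simp [h]
  · simp [h, h.not_gt, h.ne']

theorem append_le_append_iff (a x y : List ℕ) : a ++ x ≤ a ++ y ↔ x ≤ y := by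
  induction a with
  | nil => simp
  | cons z a ih => rw [List.cons_append, List.cons_append, list_cons_le_cons_iff, ih]; simp

/-- The comparison with `w` is decided before anything that follows `a` is read. This keeps ties
between maximal vertices resolved in the same way after relabelling below `a`. -/
theorem append_le_congr {a w : List ℕ} (hw : ¬ a <+: w ∨ w = a) {x y : List ℕ} (hx : x ≠ [])
    (hy : y ≠ []) : a ++ x ≤ w ↔ a ++ y ≤ w := by
  have hnil : ∀ (m : ℕ) (l : List ℕ), ¬ m :: l ≤ [] := fun m l => by simp [← not_lt]
  induction a generalizing w with
  | nil =>
    obtain rfl : w = [] := by simpa using hw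
    obtain ⟨x, l, rfl⟩ := List.exists_cons_of_ne_nil hx
    obtain ⟨y, l', rfl⟩ := List.exists_cons_of_ne_nil hy
    simp [hnil]
  | cons z a ih =>
    cases w with
    | nil => simp [hnil]
    | cons z' w =>
      rw [List.cons_append, List.cons_append, list_cons_le_cons_iff, list_cons_le_cons_iff]
      by_cases hz : z = z'
      · subst hz
        have := ih (w := w) (by simpa using hw)
        simp [this]
      · simp [hz]

namespace WTree

/-! ### Weights, the maximal vertex and the first branch point -/

theorem weight_nil (T : WTree) : T.weight [] = 1 := by simp [weight]

theorem one_le_weight {T : WTree} (hb : ∀ u, 1 < T.bias u) (v : List ℕ) : 1 ≤ T.weight v :=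
  Finset.prod_induction _ (fun x => 1 ≤ x) (fun _ _ hx hy => one_le_mul_of_one_le_of_one_le hx hy)
    le_rfl fun _ _ => (hb _).le

theorem vmax_mem_maxVerts (T : WTree) : T.vmax ∈ T.maxVerts := Finset.min'_mem _ _

theorem vmax_mem (T : WTree) : T.vmax ∈ T.verts := by
  classical exact (Finset.mem_filter.1 T.vmax_mem_maxVerts).1

theorem weight_le_weight_vmax (T : WTree) {w : List ℕ} (hw : w ∈ T.verts) :
    T.weight w ≤ T.weight T.vmax := by
  classical exact (Finset.mem_filter.1 T.vmax_mem_maxVerts).2 w hw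

theorem vmax_le (T : WTree) {w : List ℕ} (hw : w ∈ T.verts) (h : T.weight w = T.weight T.vmax) :
    T.vmax ≤ w := by
  classical
  exact Finset.min'_le _ _ <|
    Finset.mem_filter.2 ⟨hw, fun x hx => h ▸ T.weight_le_weight_vmax hx⟩

theorem vmax_eq {T : WTree} {v : List ℕ} (hv : v ∈ T.verts)
    (hmax : ∀ w ∈ T.verts, T.weight w ≤ T.weight v)
    (hmin : ∀ w ∈ T.verts, T.weight w = T.weight v → v ≤ w) : T.vmax = v :=
  le_antisymm (T.vmax_le hv (le_antisymm (T.weight_le_weight_vmax hv) (hmax _ T.vmax_mem)))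
    (hmin _ T.vmax_mem (le_antisymm (hmax _ T.vmax_mem) (T.weight_le_weight_vmax hv)))

theorem mem_of_prefix (T : WTree) {u v : List ℕ} (hv : v ∈ T.verts) (h : u <+: v) :
    u ∈ T.verts := by
  obtain ⟨t, rfl⟩ := h
  induction t using List.reverseRecOn with
  | nil => simpa using hv
  | append_singleton t m ih => exact ih (T.parent_mem _ m (by simpa using hv))

theorem IsStandard.of_prefix {κ : ℕ} {T : WTree} {u v : List ℕ} (h : IsStandard κ T v)
    (hu : u <+: v) : IsStandard κ T u := fun w j hw => h w j (hw.trans hu)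

theorem isStandard_nil (κ : ℕ) (T : WTree) : IsStandard κ T [] := fun u j h => by simp at h

/-- Standardness passes to prefixes, so two consecutive tests locate the last standard vertex. -/
theorem fbpDepth_eq_iff {κ : ℕ} {T : WTree} {d : ℕ} (hd : d < T.vmax.length) :
    T.fbpDepth κ = d ↔ IsStandard κ T (T.vmax.take d) ∧ ¬ IsStandard κ T (T.vmax.take (d + 1)) := by
  classical
  rw [fbpDepth, Nat.findGreatest_eq_iff]
  constructor
  · rintro ⟨_, h1, h2⟩
    refine ⟨?_, h2 (Nat.lt_succ_self d) hd⟩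
    rcases eq_or_ne d 0 with rfl | h
    · simpa using isStandard_nil κ T
    · exact h1 h
  · rintro ⟨h1, h2⟩
    refine ⟨hd.le, fun _ => h1, fun n hn _ h => h2 (h.of_prefix ?_)⟩
    exact List.take_prefix_take_left hn

/-! ### Offshoots and foliages -/

theorem mem_branch_verts {T : WTree} {a b r : List ℕ} :
    r ∈ (T.branch a b).verts ↔ r = [] ∨ a ++ r ∈ T.verts ∧ ¬ b <+: a ++ r := by
  simp only [branch, Finset.mem_insert, Finset.mem_image, Finset.mem_filter]
  refine or_congr_right ⟨?_, fun h => ⟨a ++ r, ⟨h.1, List.prefix_append _ _, h.2⟩, List.drop_left⟩⟩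
  rintro ⟨v, ⟨hv, ⟨t, rfl⟩, hb⟩, rfl⟩
  rw [List.drop_left]
  exact ⟨hv, hb⟩

theorem mk_eq_mk {T T' : WTree} (h : T.verts = T'.verts)
    (hb : ∀ v ∈ T.verts, v ≠ [] → T'.bias v = T.bias v) : (⟦T⟧ : UTree) = ⟦T'⟧ :=
  Quotient.sound ⟨id, by rw [h]; exact Set.bijOn_id _, rfl, fun v hv hne => ⟨rfl, hb v hv hne⟩⟩

end WTree

theorem absentFoliage_eq_of {κ i : ℕ} {T T' : WTree} (hs : T.spineLength κ = T'.spineLength κ)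
    (hb : ∀ j < T.spineLength κ,
      T.bias (T.spineVertex κ (j + 1)) = T'.bias (T'.spineVertex κ (j + 1)))
    (ho : ∀ j < T.spineLength κ, j ≠ i → (⟦T.offshoot κ j⟧ : UTree) = ⟦T'.offshoot κ j⟧) :
    absentFoliage κ i T = absentFoliage κ i T' := by
  -- The types of the components depend on the length of the spine. With `s` and `s'` as free
  -- variables, substitution makes any transport unnecessary.
  have key : ∀ (s s' : ℕ) (β β' : ℕ → ℝ) (O O' : ℕ → UTree), s = s' →
      (∀ j < s, β j = β' j) → (∀ j < s, j ≠ i → O j = O' j) →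
      (⟨s, fun j => β j, fun j => O j⟩ : AbsentFoliage i) = ⟨s', fun j => β' j, fun j => O' j⟩ := by
    rintro s _ β β' O O' rfl hβ hO
    congr 2
    · funext j
      exact hβ j j.2
    · funext j
      exact hO j.1 j.1.2 j.2
  exact key _ _ (fun j => T.bias (T.spineVertex κ (j + 1))) (fun j => T'.bias (T'.spineVertex κ (j + 1)))
    (fun j => ⟦T.offshoot κ j⟧) (fun j => ⟦T'.offshoot κ j⟧) hs hb ho

/-! ### Pruning an offshoot -/

/-- `T'` arises from `T` by exchanging the children `0` and `j` of `a`, and deleting some of the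
strict descendants of `a` outside of the subtree at `a ++ [0]`. -/
structure IsPruning (a : List ℕ) (j : ℕ) (T T' : WTree) : Prop where
  mem : ∀ u ∈ T'.verts, swapAt a j u ∈ T.verts
  mem_iff : ∀ u, (¬ a <+: u ∨ u = a ∨ a ++ [0] <+: u) → (u ∈ T'.verts ↔ swapAt a j u ∈ T.verts)
  bias : ∀ u, T'.bias u = T.bias (swapAt a j u)

theorem swapAt_of_length_le {a u : List ℕ} (j : ℕ) (h : u.length ≤ a.length) :
    swapAt a j u = u := by
  by_cases ha : a <+: u
  · rw [← ha.eq_of_length_le h, swapAt_self]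
  · exact swapAt_of_not_prefix j ha

namespace IsPruning

variable {a t : List ℕ} {j : ℕ} {T T' : WTree}

theorem mem_iff_of_length_le (H : IsPruning a j T T') {u : List ℕ} (h : u.length ≤ a.length) :
    u ∈ T'.verts ↔ u ∈ T.verts := by
  rw [H.mem_iff u, swapAt_of_length_le j h]
  by_cases ha : a <+: u
  · exact Or.inr (Or.inl (ha.eq_of_length_le h).symm)
  · exact Or.inl ha

theorem weight (H : IsPruning a j T T') (u : List ℕ) : T'.weight u = T.weight (swapAt a j u) := by
  simp only [WTree.weight, length_swapAt, H.bias, swapAt_take]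

/-- The swap transports weights and the old maximal vertex is not deleted, so the maximum persists.
Among ties, competitors below a child of `a` other than `0` now come later, and the remaining ones
compare as before. -/
theorem vmax (H : IsPruning a j T T') (hv : T.vmax = a ++ j :: t) : T'.vmax = a ++ 0 :: t := by
  have hsw := swapAt_append_zero_cons a j t
  have hw : T'.weight (a ++ 0 :: t) = T.weight T.vmax := by rw [H.weight, hsw, hv]
  refine WTree.vmax_eq ?_ ?_ ?_
  · rw [H.mem_iff _ (Or.inr (Or.inr (by simp))), hsw, ← hv]
    exact T.vmax_mem
  · intro w hw'
    rw [hw, H.weight]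
    exact T.weight_le_weight_vmax (H.mem w hw')
  · intro w hw' h
    rw [hw, H.weight] at h
    have hle := T.vmax_le (H.mem w hw') h
    rw [hv] at hle
    by_cases ha : a <+: w
    · obtain ⟨r, rfl⟩ := ha
      rw [append_le_append_iff]
      rw [swapAt_append, append_le_append_iff] at hle
      cases r with
      | nil =>
        rw [swapAt_nil_right] at hle
        exact absurd hle (by simp [← not_lt])
      | cons m r =>
        rw [swapAt_nil_cons, list_cons_le_cons_iff] at hle
        rw [list_cons_le_cons_iff]
        rcases Nat.eq_zero_or_pos m with rfl | hm
        · refine Or.inr ⟨rfl, ?_⟩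
          simpa using hle
        · exact Or.inl hm
    · rw [swapAt_of_not_prefix j ha] at hle
      exact (append_le_congr (Or.inl ha) (by simp) (by simp)).1 hle

/-- Standardness of a prefix of `a` involves only strict ancestors of `a`, their children, and the
children of those children that are off the path; the surgery touches none of these. -/
theorem isStandard_iff (H : IsPruning a j T T') {κ : ℕ} {x : List ℕ} (hx : x <+: a) :
    IsStandard κ T' x ↔ IsStandard κ T x := by
  have hch : ∀ u : List ℕ, u.length < a.length → T'.children u = T.children u := by
    intro u hu
    ext w
    constructor <;> rintro ⟨hw, m, rfl⟩
    · exact ⟨(H.mem_iff_of_length_le (by simpa using hu)).1 hw, m, rfl⟩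
    · exact ⟨(H.mem_iff_of_length_le (by simpa using hu)).2 hw, m, rfl⟩
  have hbias : ∀ u : List ℕ, u.length ≤ a.length → T'.bias u = T.bias u := by
    intro u hu
    rw [H.bias, swapAt_of_length_le j hu]
  unfold IsStandard
  refine forall_congr' fun u => forall_congr' fun l => forall_congr' fun hul => ?_
  have hlen : u.length < a.length := by
    have := (hul.trans hx).length_le
    rw [List.length_append, List.length_singleton] at this
    omega
  rw [hch u hlen]
  refine and_congr_right fun _ => forall₃_congr fun w hw hne => ?_
  obtain ⟨hwT, m, rfl⟩ := hw
  have hlen' : (u ++ [m]).length ≤ a.length := by simpa using hlen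
  rw [hbias _ hlen', hbias _ (by simpa using hlen)]
  refine and_congr_left fun _ => ?_
  -- By length, `a` could only be `u ++ [m]` itself, and then this would be the child on the path.
  have hna : ¬ a <+: u ++ [m] := by
    intro h
    have h1 := h.eq_of_length_le hlen'
    have h2 := (hul.trans hx).eq_of_length_le (by rw [h1]; simp)
    exact hne (h1.symm.trans h2.symm)
  suffices T'.children (u ++ [m]) = T.children (u ++ [m]) by rw [this]
  have hout : ∀ m', ¬ a <+: u ++ [m] ++ [m'] ∨ u ++ [m] ++ [m'] = a := fun m' => by
    by_contra! h
    rcases List.prefix_concat_iff.1 h.1 with e | e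
    · exact h.2 e.symm
    · exact hna e
  have hiff : ∀ m', u ++ [m] ++ [m'] ∈ T'.verts ↔ u ++ [m] ++ [m'] ∈ T.verts := fun m' => by
    rw [H.mem_iff _ ((hout m').imp_right Or.inl)]
    rcases hout m' with h | h
    · rw [swapAt_of_not_prefix j h]
    · rw [h, swapAt_self]
  ext w
  constructor <;> rintro ⟨hw, m', rfl⟩
  · exact ⟨(hiff m').1 hw, m', rfl⟩
  · exact ⟨(hiff m').2 hw, m', rfl⟩

/-- For `i > 0` both tests of `fbpDepth_eq_iff` concern prefixes of `a`. Only for `i = 0` does the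
second test look at the pruned offshoot, whence `h0`. -/
theorem fbpDepth (H : IsPruning a j T T') {κ d i : ℕ} (hv : T.vmax = a ++ j :: t)
    (ha : a.length = d + i) (hd : T.fbpDepth κ = d)
    (h0 : i = 0 → ¬ IsStandard κ T' (a ++ [0])) : T'.fbpDepth κ = d := by
  have hv' := H.vmax hv
  rw [WTree.fbpDepth_eq_iff (by simp [hv]; omega)] at hd
  rw [WTree.fbpDepth_eq_iff (by simp [hv']; omega)]
  rw [hv] at hd
  rw [hv']
  have htake : ∀ (n m : ℕ), n ≤ a.length → (a ++ m :: t).take n = a.take n := fun n m hn => by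
    rw [List.take_append_of_le_length hn]
  rw [htake d _ (by omega)] at hd ⊢
  refine ⟨(H.isStandard_iff (List.take_prefix _ _)).2 hd.1, ?_⟩
  rcases Nat.eq_zero_or_pos i with rfl | hi
  · have : (a ++ 0 :: t).take (d + 1) = a ++ [0] := by
      rw [show d + 1 = a.length + 1 by omega, List.take_append]
      simp
    rw [this]
    exact h0 rfl
  · rw [htake (d + 1) _ (by omega)] at hd ⊢
    rw [H.isStandard_iff (List.take_prefix _ _)]
    exact hd.2

theorem absentFoliage (H : IsPruning a j T T') {κ d i : ℕ} (hv : T.vmax = a ++ j :: t)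
    (ha : a.length = d + i) (hd : T.fbpDepth κ = d)
    (h0 : i = 0 → ¬ IsStandard κ T' (a ++ [0])) :
    WeightedGW.absentFoliage κ i T = WeightedGW.absentFoliage κ i T' := by
  have hv' := H.vmax hv
  have hd' := H.fbpDepth hv ha hd h0
  have hlen : T'.vmax.length = T.vmax.length := by rw [hv, hv']; simp
  have hsw : ∀ n, swapAt a j (T'.spineVertex κ n) = T.spineVertex κ n := fun n => by
    rw [WTree.spineVertex, WTree.spineVertex, hd, hd', swapAt_take, hv', hv, swapAt_append_zero_cons]
  refine absentFoliage_eq_of (by rw [WTree.spineLength, WTree.spineLength, hd, hd', hlen])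
    (fun n _ => by rw [H.bias, hsw]) fun n _ hni => ?_
  -- Offshoots before the `i`-th lie outside the subtree at `a`, where the swap is the identity.
  -- Later ones lie below the spine child of `a`, where the swap only exchanges `0` and `j`.
  have hpre : ∀ (n : ℕ) (r : List ℕ), (n < i → ¬ T.spineVertex κ (n + 1) <+: T.spineVertex κ n ++ r) →
      n ≠ i → swapAt a j (T'.spineVertex κ n ++ r) = T.spineVertex κ n ++ r ∧
        (¬ a <+: T'.spineVertex κ n ++ r ∨ a ++ [0] <+: T'.spineVertex κ n ++ r) := by
    intro n r hr hn
    rcases lt_or_gt_of_ne hn with hn | hn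
    · have e : ∀ m ≤ i, T.spineVertex κ m = a.take (d + m) := fun m hm => by
        rw [WTree.spineVertex, hd, hv, List.take_append_of_le_length (by omega)]
      have e' : T'.spineVertex κ n = a.take (d + n) := by
        rw [WTree.spineVertex, hd', hv', List.take_append_of_le_length (by omega)]
      have hna : ¬ a <+: a.take (d + n) ++ r := fun h => by
        refine hr hn ?_
        rw [e _ hn, e _ hn.le]
        exact (List.take_prefix _ _).trans h
      rw [e', e _ hn.le]
      exact ⟨swapAt_of_not_prefix j hna, Or.inl hna⟩
    · have e : ∀ m, (a ++ m :: t).take (d + n) = a ++ m :: t.take (n - i - 1) := fun m => by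
        rw [List.take_append, List.take_of_length_le (by omega),
          show d + n - a.length = (n - i - 1) + 1 by omega, List.take_succ_cons]
      rw [WTree.spineVertex, WTree.spineVertex, hd, hd', hv, hv', e, e, List.append_assoc,
        List.append_assoc, List.cons_append, List.cons_append, swapAt_append_zero_cons]
      exact ⟨rfl, Or.inr (by simp)⟩
  have hmem : ∀ r, r ∈ (T.offshoot κ n).verts ↔ r ∈ (T'.offshoot κ n).verts := by
    intro r
    rw [WTree.offshoot, WTree.offshoot, WTree.mem_branch_verts, WTree.mem_branch_verts]
    refine or_congr_right ?_
    by_cases hr : n < i → ¬ T.spineVertex κ (n + 1) <+: T.spineVertex κ n ++ r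
    · obtain ⟨h1, h2⟩ := hpre n r hr hni
      rw [H.mem_iff _ (h2.imp_right Or.inr), h1, ← h1, ← hsw (n + 1), swapAt_prefix_iff]
    · push Not at hr
      refine iff_of_false (fun h => h.2 hr.2) fun h => h.2 ?_
      have hn := hr.1
      have e' : ∀ m ≤ i, T'.spineVertex κ m = T.spineVertex κ m := fun m hm => by
        rw [← hsw m, swapAt_of_length_le]
        rw [WTree.spineVertex, hd']
        simp
        omega
      rw [e' _ hn, e' _ hn.le]
      exact hr.2
  refine WTree.mk_eq_mk (Finset.ext hmem) fun r hr hne => ?_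
  have hr' : n < i → ¬ T.spineVertex κ (n + 1) <+: T.spineVertex κ n ++ r := fun _ =>
    ((WTree.mem_branch_verts.1 hr).resolve_left hne).2
  change T'.bias (_ ++ r) = T.bias (_ ++ r)
  rw [H.bias, (hpre n r hr' hni).1]

theorem offshoot_eq_branch {κ d i : ℕ} (hv : T.vmax = a ++ j :: t) (ha : a.length = d + i)
    (hd : T.fbpDepth κ = d) : T.offshoot κ i = T.branch a (a ++ [j]) := by
  have h1 : T.spineVertex κ i = a := by
    rw [WTree.spineVertex, hd, hv, ← ha, List.take_left]
  have h2 : T.spineVertex κ (i + 1) = a ++ [j] := by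
    rw [WTree.spineVertex, hd, hv, ← add_assoc, ← ha, List.take_append]
    simp
  rw [WTree.offshoot, h1, h2]

/-- Vertices outside the offshoot, and its root `a`, survive with their weights and contribute at
most the new total. Each of the other vertices of the offshoot weighs at most the maximum, which is
itself a term of the new total. -/
theorem totalWeight_le (H : IsPruning a j T T') {κ d i : ℕ} (hv : T.vmax = a ++ j :: t)
    (ha : a.length = d + i) (hd : T.fbpDepth κ = d) (hb : ∀ u, 1 < T.bias u) :
    T.totalWeight ≤ (T.offshoot κ i).verts.card * T'.totalWeight := by
  classical
  rw [offshoot_eq_branch hv ha hd]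
  have hpos : ∀ u, 0 ≤ T.weight u := fun u => zero_le_one.trans (WTree.one_le_weight hb u)
  have hpos' : ∀ u, 0 ≤ T'.weight u := fun u => by rw [H.weight]; exact hpos _
  have hmax : ∀ u ∈ T.verts, T.weight u ≤ T'.totalWeight := by
    intro u hu
    have h1 : T'.weight T'.vmax = T.weight T.vmax := by
      rw [H.weight, H.vmax hv, swapAt_append_zero_cons, hv]
    refine (T.weight_le_weight_vmax hu).trans (h1 ▸ ?_)
    exact Finset.single_le_sum (f := T'.weight) (fun _ _ => hpos' _) T'.vmax_mem
  set N := T.verts.filter fun u => a <+: u ∧ u ≠ a ∧ ¬ a ++ [j] <+: u with hN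
  have hsplit : T.totalWeight ≤ T'.totalWeight + N.card * T'.totalWeight := by
    rw [WTree.totalWeight, ← Finset.sum_filter_not_add_sum_filter T.verts
      (fun u => a <+: u ∧ u ≠ a ∧ ¬ a ++ [j] <+: u)]
    refine add_le_add ?_ ?_
    · have : T'.totalWeight = ∑ u ∈ T'.verts.image (swapAt a j), T.weight u := by
        rw [Finset.sum_image fun x _ y _ h => swapAt_injective a j h]
        exact Finset.sum_congr rfl fun u _ => H.weight u
      rw [this]
      refine Finset.sum_le_sum_of_subset_of_nonneg ?_ fun _ _ _ => hpos _
      intro u hu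
      rw [Finset.mem_filter] at hu
      refine Finset.mem_image.2 ⟨swapAt a j u, ?_, swapAt_swapAt a j u⟩
      rw [H.mem_iff, swapAt_swapAt]
      · exact hu.1
      · have h := hu.2
        rw [prefix_swapAt_iff]
        by_cases h1 : a <+: u
        · by_cases h2 : u = a
          · subst h2
            exact Or.inr (Or.inl (swapAt_self _ _))
          · refine Or.inr (Or.inr ?_)
            have h3 : a ++ [j] <+: u := by
              by_contra h3
              exact h ⟨h1, h2, h3⟩
            rw [← swapAt_append_zero_cons] at h3
            simpa [swapAt_swapAt] using swapAt_prefix (a := a) (j := j) h3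
        · exact Or.inl h1
    · rw [← nsmul_eq_mul]
      exact Finset.sum_le_card_nsmul _ _ _ fun u hu => hmax u (Finset.mem_filter.1 hu).1
  have hcard : N.card + 1 ≤ (T.branch a (a ++ [j])).verts.card := by
    have hsub : insert a N ⊆ (T.branch a (a ++ [j])).verts.image (a ++ ·) := by
      intro u hu
      rw [Finset.mem_insert] at hu
      rcases hu with rfl | hu
      · exact Finset.mem_image.2 ⟨[], WTree.root_mem _, by simp⟩
      · obtain ⟨h1, ⟨r, rfl⟩, -, h3⟩ := Finset.mem_filter.1 hu
        exact Finset.mem_image.2 ⟨r, WTree.mem_branch_verts.2 (Or.inr ⟨h1, h3⟩), rfl⟩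
    have := (Finset.card_le_card hsub).trans Finset.card_image_le
    rwa [Finset.card_insert_of_notMem (by simp [hN])] at this
  have hT' : 0 ≤ T'.totalWeight := Finset.sum_nonneg fun _ _ => hpos' _
  calc T.totalWeight ≤ ((N.card + 1 : ℕ) : ℝ) * T'.totalWeight := by push_cast; linarith
    _ ≤ _ := by gcongr

end IsPruning

/-! ### Prolonging the path to the first branch point -/

/-- `T` arises from `T'` by adding a new root, with `κ` children of which the first one is the root
of `T'` and the others are childless and attached by an edge of smaller bias. -/
structure IsProlongation (κ : ℕ) (T' T : WTree) : Prop where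
  mem_cons_zero : ∀ u, 0 :: u ∈ T.verts ↔ u ∈ T'.verts
  singleton_mem : ∀ m, [m] ∈ T.verts ↔ m < κ
  childless : ∀ m ≠ 0, ∀ u, m :: u ∈ T.verts → u = []
  bias_cons_zero : ∀ u ≠ [], T.bias (0 :: u) = T'.bias u
  bias_lt : ∀ m ≠ 0, m < κ → T.bias [m] < T.bias [0]

namespace IsProlongation

variable {κ : ℕ} {T T' : WTree}

theorem weight_cons_zero (H : IsProlongation κ T' T) (u : List ℕ) :
    T.weight (0 :: u) = T.bias [0] * T'.weight u := by
  rw [WTree.weight, WTree.weight, List.length_cons, Finset.prod_range_succ', mul_comm]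
  simp only [List.take_succ_cons, List.take_zero]
  congr 1
  refine Finset.prod_congr rfl fun i hi => H.bias_cons_zero _ fun h => ?_
  rw [List.take_eq_nil_iff] at h
  rw [Finset.mem_range] at hi
  rcases h with h | h
  · omega
  · simp [h] at hi

theorem weight_singleton (T : WTree) (m : ℕ) : T.weight [m] = T.bias [m] := by
  simp [WTree.weight]

/-- The added vertices cannot compete: the new root has weight `1`, and each new leaf weighs
strictly less than `[0]`, which in turn weighs no more than the shifted maximal vertex. -/
theorem vmax (H : IsProlongation κ T' T) (hb : ∀ u, 1 < T.bias u) (hb' : ∀ u, 1 < T'.bias u) :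
    T.vmax = 0 :: T'.vmax := by
  have h1 : T.bias [0] ≤ T.weight (0 :: T'.vmax) := by
    rw [H.weight_cons_zero]
    exact le_mul_of_one_le_right (zero_le_one.trans (hb _).le) (WTree.one_le_weight hb' _)
  have hpos : 0 < T.bias [0] := zero_lt_one.trans (hb _)
  have hcases : ∀ w ∈ T.verts, T.weight w < T.weight (0 :: T'.vmax) ∨
      ∃ u ∈ T'.verts, w = 0 :: u := by
    intro w hw
    cases w with
    | nil => rw [WTree.weight_nil]; exact Or.inl ((hb _).trans_le h1)
    | cons m u =>
      by_cases hm : m = 0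
      · subst hm
        exact Or.inr ⟨u, (H.mem_cons_zero u).1 hw, rfl⟩
      · obtain rfl := H.childless m hm u hw
        rw [weight_singleton]
        exact Or.inl ((H.bias_lt m hm ((H.singleton_mem m).1 hw)).trans_le h1)
  refine WTree.vmax_eq ((H.mem_cons_zero _).2 T'.vmax_mem) ?_ ?_
  · intro w hw
    rcases hcases w hw with h | ⟨u, hu, rfl⟩
    · exact h.le
    · rw [H.weight_cons_zero, H.weight_cons_zero]
      exact mul_le_mul_of_nonneg_left (T'.weight_le_weight_vmax hu) hpos.le
  · intro w hw he
    rcases hcases w hw with h | ⟨u, hu, rfl⟩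
    · exact absurd he h.ne
    · rw [H.weight_cons_zero, H.weight_cons_zero] at he
      rw [list_cons_le_cons_iff]
      exact Or.inr ⟨rfl, T'.vmax_le hu (mul_left_cancel₀ hpos.ne' he)⟩

theorem children_cons_zero (H : IsProlongation κ T' T) (u : List ℕ) :
    T.children (0 :: u) = List.cons 0 '' T'.children u := by
  ext w
  constructor
  · rintro ⟨hw, m, rfl⟩
    exact ⟨u ++ [m], ⟨(H.mem_cons_zero _).1 hw, m, rfl⟩, rfl⟩
  · rintro ⟨_, ⟨hw, m, rfl⟩, rfl⟩
    exact ⟨(H.mem_cons_zero _).2 hw, m, rfl⟩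

theorem children_nil (H : IsProlongation κ T' T) :
    T.children [] = (fun m => [m]) '' (Finset.range κ : Set ℕ) := by
  ext w
  constructor
  · rintro ⟨hw, m, rfl⟩
    exact ⟨m, by simpa using (H.singleton_mem m).1 hw, rfl⟩
  · rintro ⟨m, hm, rfl⟩
    exact ⟨(H.singleton_mem m).2 (by simpa using hm), m, rfl⟩

theorem isStandard_cons_zero (H : IsProlongation κ T' T) (x : List ℕ) :
    IsStandard κ T (0 :: x) ↔ IsStandard κ T' x := by
  have hcons : Function.Injective (List.cons 0 : List ℕ → List ℕ) := List.cons_injective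
  have key : ∀ u j, (T.children (0 :: u)).ncard = κ ∧
      (∀ w ∈ T.children (0 :: u), w ≠ 0 :: u ++ [j] →
        T.children w = ∅ ∧ T.bias w < T.bias (0 :: u ++ [j])) ↔
      (T'.children u).ncard = κ ∧
      ∀ w ∈ T'.children u, w ≠ u ++ [j] → T'.children w = ∅ ∧ T'.bias w < T'.bias (u ++ [j]) := by
    intro u j
    rw [H.children_cons_zero, Set.ncard_image_of_injective _ hcons, Set.forall_mem_image]
    refine and_congr_right fun _ => forall₂_congr fun w hw => ?_
    obtain ⟨-, m, rfl⟩ := hw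
    rw [H.children_cons_zero, Set.image_eq_empty, List.cons_append,
      H.bias_cons_zero _ (by simp), H.bias_cons_zero _ (by simp), Ne, Ne, hcons.eq_iff]
  constructor
  · intro h u j hu
    exact (key u j).1 (h (0 :: u) j (by simpa using hu))
  · intro h u j hu
    cases u with
    | nil =>
      obtain rfl : j = 0 := by simpa using hu
      refine ⟨?_, ?_⟩
      · rw [H.children_nil, Set.ncard_image_of_injective _ (fun a b h => by simpa using h)]
        simp
      · rintro w ⟨hw, m, rfl⟩ hne
        have hm : m ≠ 0 := by rintro rfl; exact hne rfl
        refine ⟨?_, H.bias_lt m hm ((H.singleton_mem m).1 hw)⟩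
        rw [Set.eq_empty_iff_forall_notMem]
        rintro _ ⟨hw', l, rfl⟩
        simpa using H.childless m hm [l] hw'
    | cons m u =>
      obtain ⟨rfl, hu'⟩ : m = 0 ∧ u ++ [j] <+: x := by simpa using hu
      exact (key u j).2 (h u j hu')

theorem fbpDepth (H : IsProlongation κ T' T) (hb : ∀ u, 1 < T.bias u) (hb' : ∀ u, 1 < T'.bias u)
    (hs : 0 < T'.spineLength κ) : T.fbpDepth κ = T'.fbpDepth κ + 1 := by
  have hv := H.vmax hb hb'
  have hlt : T'.fbpDepth κ < T'.vmax.length := by rw [WTree.spineLength] at hs; omega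
  rw [WTree.fbpDepth_eq_iff (by rw [hv, List.length_cons]; omega), hv, List.take_succ_cons,
    List.take_succ_cons, H.isStandard_cons_zero, H.isStandard_cons_zero]
  exact (WTree.fbpDepth_eq_iff hlt).1 rfl

theorem spineVertex (H : IsProlongation κ T' T) (hb : ∀ u, 1 < T.bias u)
    (hb' : ∀ u, 1 < T'.bias u) (hs : 0 < T'.spineLength κ) (n : ℕ) :
    T.spineVertex κ n = 0 :: T'.spineVertex κ n := by
  rw [WTree.spineVertex, WTree.spineVertex, H.fbpDepth hb hb' hs, H.vmax hb hb', Nat.add_right_comm,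
    List.take_succ_cons]

theorem absentFoliage (H : IsProlongation κ T' T) (hb : ∀ u, 1 < T.bias u)
    (hb' : ∀ u, 1 < T'.bias u) (hs : 0 < T'.spineLength κ) (i : ℕ) :
    WeightedGW.absentFoliage κ i T = WeightedGW.absentFoliage κ i T' := by
  have hsl : T.spineLength κ = T'.spineLength κ := by
    rw [WTree.spineLength, WTree.spineLength, H.fbpDepth hb hb' hs, H.vmax hb hb', List.length_cons]
    omega
  refine absentFoliage_eq_of hsl (fun n hn => ?_) fun n hn _ => ?_
  · rw [H.spineVertex hb hb' hs, H.bias_cons_zero]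
    rw [WTree.spineVertex, Ne, List.take_eq_nil_iff]
    rw [hsl, WTree.spineLength] at hn
    rintro (h | h)
    · omega
    · simp [h] at hn
  · have hmem : ∀ r, r ∈ (T.offshoot κ n).verts ↔ r ∈ (T'.offshoot κ n).verts := by
      intro r
      rw [WTree.offshoot, WTree.offshoot, WTree.mem_branch_verts, WTree.mem_branch_verts,
        H.spineVertex hb hb' hs, H.spineVertex hb hb' hs, List.cons_append, H.mem_cons_zero,
        List.prefix_cons_inj]
    refine WTree.mk_eq_mk (Finset.ext hmem) fun r _ hr => ?_
    change T'.bias (_ ++ r) = T.bias (_ ++ r)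
    rw [H.spineVertex hb hb' hs, List.cons_append, H.bias_cons_zero _ (by simp [hr])]

theorem mul_totalWeight_le (H : IsProlongation κ T' T) (hb : ∀ u, 1 < T.bias u) :
    T.bias [0] * T'.totalWeight ≤ T.totalWeight := by
  classical
  rw [WTree.totalWeight, Finset.mul_sum]
  calc ∑ u ∈ T'.verts, T.bias [0] * T'.weight u
      = ∑ u ∈ T'.verts.image (List.cons 0), T.weight u := by
        rw [Finset.sum_image fun x _ y _ h => List.cons_injective h]
        exact Finset.sum_congr rfl fun u _ => (H.weight_cons_zero u).symm
    _ ≤ ∑ u ∈ T.verts, T.weight u := by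
        refine Finset.sum_le_sum_of_subset_of_nonneg ?_ fun u _ _ =>
          zero_le_one.trans (WTree.one_le_weight hb u)
        intro u hu
        obtain ⟨w, hw, rfl⟩ := Finset.mem_image.1 hu
        exact (H.mem_cons_zero w).2 hw

end IsProlongation

theorem WTree.one_le_totalWeight {T : WTree} (hb : ∀ u, 1 < T.bias u) : 1 ≤ T.totalWeight := by
  rw [← T.weight_nil]
  exact Finset.single_le_sum (f := T.weight)
    (fun u _ => zero_le_one.trans (WTree.one_le_weight hb u)) T.root_mem

/-! ### Operations on families of numbers of offspring -/

theorem gwVerts_mono {K K' : List ℕ → ℕ} (h : ∀ u, K u ≤ K' u) : gwVerts K ⊆ gwVerts K' :=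
  fun _ hu v j hv => (hu v j hv).trans_le (h v)

theorem gw_isProlongation {κ : ℕ} {K : List ℕ → ℕ} {b b' : List ℕ → ℝ} (hκ : 0 < κ)
    (h0 : K [] = κ) (hK : ∀ m ≠ 0, m < κ → K [m] = 0)
    (hfin : (gwVerts fun u => K (0 :: u)).Finite) (hb' : ∀ u ≠ [], b (0 :: u) = b' u)
    (hb : ∀ m ≠ 0, m < κ → b [m] < b [0]) :
    IsProlongation κ (gw (fun u => K (0 :: u)) b') (gw K b) := by
  have hch : ∀ m ≠ 0, ∀ u, m :: u ∈ gwVerts K → u = [] := by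
    intro m hm u hu
    obtain ⟨h1, h2⟩ := cons_mem_gwVerts.1 hu
    cases u with
    | nil => rfl
    | cons l u =>
      rw [cons_mem_gwVerts] at h2
      have := h2.1
      rw [hK m hm (h0 ▸ h1)] at this
      omega
  have hK' : (gwVerts K).Finite := by
    refine (((Set.finite_singleton []).union ((Set.finite_Iio κ).image fun m => [m])).union
      (hfin.image (List.cons 0))).subset fun u hu => ?_
    cases u with
    | nil => simp
    | cons m u =>
      by_cases hm : m = 0
      · subst hm
        exact Or.inr ⟨u, (cons_mem_gwVerts.1 hu).2, rfl⟩
      · obtain rfl := hch m hm u hu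
        exact Or.inl (Or.inr ⟨m, by simpa [h0] using singleton_mem_gwVerts.1 hu, rfl⟩)
  refine ⟨fun u => ?_, fun m => ?_, fun m hm u hu => ?_, fun u hu => ?_, fun m hm hmκ => ?_⟩
  · rw [mem_gw_verts hK', mem_gw_verts hfin, cons_mem_gwVerts, h0, and_iff_right hκ]
  · rw [mem_gw_verts hK', singleton_mem_gwVerts, h0]
  · exact hch m hm u ((mem_gw_verts hK').1 hu)
  · rw [gw_bias, gw_bias, hb' u hu]
  · rw [gw_bias]
    exact hb m hm hmκ

/-! ### Replacing the numbers of offspring in one offshoot. -/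

/-- The labels of the descendants of `a` outside of the subtree at `a ++ [0]`. -/
def offLabels (a : List ℕ) : Set (List ℕ) := {u | a <+: u ∧ ¬ a ++ [0] <+: u}

theorem append_mem_offLabels {a r : List ℕ} : a ++ r ∈ offLabels a ↔ ¬ [0] <+: r := by
  simp [offLabels]

open Classical in
/-- The family `K` with its values on the descendants of `a` outside of the subtree at `a ++ [0]`
replaced by those of `S`. -/
def modify (a : List ℕ) (S K : List ℕ → ℕ) (u : List ℕ) : ℕ :=
  if u ∈ offLabels a then S (u.drop a.length) else K u

theorem modify_of_notMem {a u : List ℕ} (S K : List ℕ → ℕ) (hu : u ∉ offLabels a) :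
    modify a S K u = K u := if_neg hu

theorem modify_append {a r : List ℕ} (S K : List ℕ → ℕ) (hr : ¬ [0] <+: r) :
    modify a S K (a ++ r) = S r := by
  rw [modify, if_pos (append_mem_offLabels.2 hr), List.drop_left]

theorem modify_self (a : List ℕ) (S K : List ℕ → ℕ) : modify a S K a = S [] := by
  simpa using modify_append (a := a) (r := []) S K (by simp)

theorem mem_gwVerts_modify_iff {a : List ℕ} {S K : List ℕ → ℕ} (hS : 0 < S []) (ha : 0 < K a)
    {u : List ℕ} (hu : ¬ a <+: u ∨ u = a ∨ a ++ [0] <+: u) :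
    u ∈ gwVerts (modify a S K) ↔ u ∈ gwVerts K := by
  induction u using List.reverseRecOn with
  | nil => simp [nil_mem_gwVerts]
  | append_singleton u m ih =>
    rw [concat_mem_gwVerts, concat_mem_gwVerts]
    by_cases hua : u = a
    · subst hua
      have hm : m = 0 := by simpa [eq_comm] using hu
      rw [ih (Or.inr (Or.inl rfl)), modify_self, hm]
      simp [hS, ha]
    · have : ¬ a <+: u ∨ a ++ [0] <+: u := by
        rcases hu with h | h | h
        · exact Or.inl fun h' => h (h'.trans (List.prefix_append _ _))
        · refine Or.inl fun h' => ?_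
          have := h'.length_le
          rw [← h] at this
          simp at this
        · rcases List.prefix_concat_iff.1 h with e | e
          · exact absurd (List.append_inj_left' e rfl).symm hua
          · exact Or.inr e
      rw [ih (this.imp_right Or.inr), modify_of_notMem]
      rintro ⟨h1, h2⟩
      exact this.elim (fun h => h h1) h2

/-- The swap moves the spine child to label `0`, which is available as soon as `S []` is positive,
whereas `j` may exceed the number of children that the shape keeps. -/
theorem gw_isPruning {a : List ℕ} {j : ℕ} {S K : List ℕ → ℕ} (b : List ℕ → ℝ) (hj : j < K a)
    (hK : (gwVerts K).Finite) (hS : 0 < S [])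
    (hSK : ∀ r, ¬ [0] <+: r → S r ≤ K (swapAt a j (a ++ r))) :
    IsPruning a j (gw K b) (gw (modify a S (K ∘ swapAt a j)) (b ∘ swapAt a j)) := by
  have hle : ∀ u, modify a S (K ∘ swapAt a j) u ≤ (K ∘ swapAt a j) u := by
    intro u
    by_cases hu : u ∈ offLabels a
    · obtain ⟨r, rfl⟩ := hu.1
      rw [modify_append _ _ (append_mem_offLabels.1 hu)]
      exact hSK r (append_mem_offLabels.1 hu)
    · rw [modify_of_notMem _ _ hu]
  have hsub : ∀ u ∈ gwVerts (modify a S (K ∘ swapAt a j)), swapAt a j u ∈ gwVerts K :=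
    fun u hu => (mem_gwVerts_comp_swapAt hj).1 (gwVerts_mono hle hu)
  have hfin : (gwVerts (modify a S (K ∘ swapAt a j))).Finite :=
    (hK.preimage (swapAt_injective a j).injOn).subset hsub
  refine ⟨fun u hu => ?_, fun u hu => ?_, fun u => ?_⟩
  · rw [mem_gw_verts hfin] at hu
    rw [mem_gw_verts hK]
    exact hsub u hu
  · rw [mem_gw_verts hfin, mem_gw_verts hK, ← mem_gwVerts_comp_swapAt hj,
      mem_gwVerts_modify_iff hS _ hu]
    rw [Function.comp_apply, swapAt_self]
    omega
  · rw [gw_bias, gw_bias, Function.comp_apply]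

/-- The labels, relative to the root, of the vertices outside of the subtree at `[0]`. -/
def offshootVerts (K : List ℕ → ℕ) : Set (List ℕ) := {r | r ∈ gwVerts K ∧ ¬ [0] <+: r}

theorem offshootVerts_eq_of_eqOn {K K' : List ℕ → ℕ} (h : ∀ r ∈ offshootVerts K, K' r = K r) :
    offshootVerts K' = offshootVerts K := by
  have key : ∀ r, ¬ [0] <+: r → (r ∈ gwVerts K' ↔ r ∈ gwVerts K) := by
    intro r hr
    induction r using List.reverseRecOn with
    | nil => simp [nil_mem_gwVerts]
    | append_singleton r m ih =>
      have hr' : ¬ [0] <+: r := fun h => hr (h.trans (List.prefix_append _ _))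
      rw [concat_mem_gwVerts, concat_mem_gwVerts, ih hr']
      exact and_congr_right fun hK => by rw [h r ⟨hK, hr'⟩]
  ext r
  exact and_congr_left fun hr => key r hr

/-- If `K` already has the shape `S` below `a`, the replacement changes values only at labels that
are not vertices. -/
theorem gwVerts_modify_eq {a : List ℕ} {S K : List ℕ → ℕ}
    (h : ∀ r ∈ offshootVerts S, K (a ++ r) = S r) :
    gwVerts (modify a S K) = gwVerts K := by
  have hoff := offshootVerts_eq_of_eqOn h
  ext u
  induction u using List.reverseRecOn with
  | nil => simp [nil_mem_gwVerts]
  | append_singleton u m ih =>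
    rw [concat_mem_gwVerts, concat_mem_gwVerts, ih]
    refine and_congr_right fun hu => ?_
    by_cases hmem : u ∈ offLabels a
    · obtain ⟨r, rfl⟩ := hmem.1
      have hr := append_mem_offLabels.1 hmem
      rw [modify_append _ _ hr, h r]
      rw [← hoff]
      exact ⟨(append_mem_gwVerts.1 hu).2, hr⟩
    · rw [modify_of_notMem _ _ hmem]

theorem card_branch_gw {a : List ℕ} {j : ℕ} {K : List ℕ → ℕ} (b : List ℕ → ℝ)
    (ha : a ∈ gwVerts K) (hj : j < K a) (hK : (gwVerts K).Finite) :
    ((gw K b).branch a (a ++ [j])).verts.card =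
      (offshootVerts fun r => K (swapAt a j (a ++ r))).ncard := by
  have ha' : a ∈ gwVerts (K ∘ swapAt a j) := by
    rwa [mem_gwVerts_comp_swapAt hj, swapAt_self]
  have himg : (((gw K b).branch a (a ++ [j])).verts : Set (List ℕ)) =
      swapAt [] j '' offshootVerts fun r => K (swapAt a j (a ++ r)) := by
    ext r
    have hr : r ∈ swapAt [] j '' (offshootVerts fun r => K (swapAt a j (a ++ r))) ↔
        swapAt [] j r ∈ offshootVerts fun r => K (swapAt a j (a ++ r)) := by
      constructor
      · rintro ⟨x, hx, rfl⟩
        rwa [swapAt_swapAt]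
      · exact fun h => ⟨_, h, swapAt_swapAt _ _ _⟩
    have h1 : swapAt [] j r ∈ gwVerts (fun r => K (swapAt a j (a ++ r))) ↔ a ++ r ∈ gwVerts K := by
      have := append_mem_gwVerts (K := K ∘ swapAt a j) (a := a) (u := swapAt [] j r)
      rw [and_iff_right ha', mem_gwVerts_comp_swapAt hj, swapAt_append, swapAt_swapAt] at this
      exact this.symm
    have h2 : [0] <+: swapAt [] j r ↔ [j] <+: r := by
      rw [← swapAt_prefix_iff (a := []) (j := j), swapAt_swapAt]
      simp
    rw [hr, Finset.mem_coe, WTree.mem_branch_verts, mem_gw_verts hK, offshootVerts,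
      Set.mem_ofPred_eq, h1, h2, List.prefix_append_right_inj, or_iff_right_of_imp]
    rintro rfl
    simpa using ha
  rw [← Set.ncard_coe_finset, himg, Set.ncard_image_of_injective _ (swapAt_injective [] j)]

/-! ### Product measures -/

section InfinitePi

variable {ι X : Type*} [MeasurableSpace X] (ρ : Measure X) [IsProbabilityMeasure ρ]

theorem infinitePi_map_comp_injective {e : ι → ι} (he : Function.Injective e) :
    (Measure.infinitePi fun _ : ι => ρ).map (fun x => x ∘ e) = Measure.infinitePi fun _ : ι => ρ := by
  classical
  refine Measure.eq_infinitePi _ fun s t ht => ?_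
  have hm : Measurable fun x : ι → X => x ∘ e :=
    measurable_pi_lambda _ fun i => measurable_pi_apply (e i)
  rw [Measure.map_apply hm (MeasurableSet.pi s.countable_toSet fun i _ => ht i)]
  rcases isEmpty_or_nonempty ι with h | h
  · have hs : s = ∅ := Finset.eq_empty_of_isEmpty s
    simp [hs]
  have hpre : (fun x : ι → X => x ∘ e) ⁻¹' Set.pi s t =
      Set.pi (s.image e : Finset ι) fun k => t (Function.invFun e k) := by
    ext x
    simp [Set.mem_pi, Function.leftInverse_invFun he _]
  rw [hpre, Measure.infinitePi_pi _ (fun k _ => ht _), Finset.prod_image fun i _ k _ h => he h]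
  simp [Function.leftInverse_invFun he _]

-- Splicing two independent samples along `S` gives a sample of the same law. Independence of
-- functionals that read disjoint sets of labels follows from this.
open Classical in
theorem infinitePi_prod_map_piecewise (S : Set ι) :
    ((Measure.infinitePi fun _ : ι => ρ).prod (Measure.infinitePi fun _ : ι => ρ)).map
      (fun p i => if i ∈ S then p.1 i else p.2 i) = Measure.infinitePi fun _ : ι => ρ := by
  refine Measure.eq_infinitePi _ fun s t ht => ?_
  have hm : Measurable fun (p : (ι → X) × (ι → X)) i => if i ∈ S then p.1 i else p.2 i := by
    refine measurable_pi_lambda _ fun i => ?_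
    by_cases hi : i ∈ S
    · simpa [hi] using measurable_fst.eval (a := i)
    · simpa [hi] using measurable_snd.eval (a := i)
  rw [Measure.map_apply hm (MeasurableSet.pi s.countable_toSet fun i _ => ht i)]
  have hpre : (fun (p : (ι → X) × (ι → X)) i => if i ∈ S then p.1 i else p.2 i) ⁻¹' Set.pi s t =
      Set.pi (s.filter (· ∈ S) : Finset ι) t ×ˢ Set.pi (s.filter (· ∉ S) : Finset ι) t := by
    ext p
    simp only [Set.mem_preimage, Set.mem_pi, Set.mem_prod, Finset.coe_filter, Finset.mem_coe,
      Set.mem_ofPred_eq]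
    constructor
    · intro h
      exact ⟨fun i hi => by simpa [hi.2] using h i hi.1, fun i hi => by simpa [hi.2] using h i hi.1⟩
    · intro h i hi
      by_cases hiS : i ∈ S
      · simpa [hiS] using h.1 i ⟨hi, hiS⟩
      · simpa [hiS] using h.2 i ⟨hi, hiS⟩
  rw [hpre, Measure.prod_prod, Measure.infinitePi_pi _ (fun k _ => ht _),
    Measure.infinitePi_pi _ (fun k _ => ht _), Finset.prod_filter_mul_prod_filter_not]

theorem lintegral_infinitePi_mul (S : Set ι) {f g : (ι → X) → ℝ≥0∞} (hf : Measurable f)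
    (hg : Measurable g) (hfS : ∀ x y, (∀ i ∈ S, x i = y i) → f x = f y)
    (hgS : ∀ x y, (∀ i ∉ S, x i = y i) → g x = g y) :
    ∫⁻ x, f x * g x ∂(Measure.infinitePi fun _ : ι => ρ) =
      (∫⁻ x, f x ∂(Measure.infinitePi fun _ : ι => ρ)) *
        ∫⁻ x, g x ∂(Measure.infinitePi fun _ : ι => ρ) := by
  classical
  have hm : Measurable fun (p : (ι → X) × (ι → X)) i => if i ∈ S then p.1 i else p.2 i := by
    refine measurable_pi_lambda _ fun i => ?_
    by_cases hi : i ∈ S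
    · simpa [hi] using measurable_fst.eval (a := i)
    · simpa [hi] using measurable_snd.eval (a := i)
  rw [← lintegral_prod_mul hf.aemeasurable hg.aemeasurable]
  conv_lhs => rw [← infinitePi_prod_map_piecewise ρ S]
  rw [lintegral_map (f := fun x => f x * g x) (hf.mul hg) hm]
  refine lintegral_congr fun p => ?_
  congr 1
  · exact hfS _ _ fun i hi => by simp [hi]
  · exact hgS _ _ fun i hi => by simp [hi]

theorem infinitePi_inter (S : Set ι) {A B : Set (ι → X)} (hA : MeasurableSet A)
    (hB : MeasurableSet B) (hAS : ∀ x y, (∀ i ∈ S, x i = y i) → x ∈ A → y ∈ A)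
    (hBS : ∀ x y, (∀ i ∉ S, x i = y i) → x ∈ B → y ∈ B) :
    (Measure.infinitePi fun _ : ι => ρ) (A ∩ B) =
      (Measure.infinitePi fun _ : ι => ρ) A * (Measure.infinitePi fun _ : ι => ρ) B := by
  have := lintegral_infinitePi_mul ρ S (f := A.indicator 1) (g := B.indicator 1)
    (measurable_one.indicator hA) (measurable_one.indicator hB) ?_ ?_
  · rw [lintegral_indicator_one hA, lintegral_indicator_one hB] at this
    rw [← this, ← lintegral_indicator_one (hA.inter hB)]
    simp [Set.inter_indicator_one]
  · intro x y h
    by_cases hy : y ∈ A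
    · simp [hy, hAS y x (fun i hi => (h i hi).symm) hy]
    · simp [hy, mt (hAS x y h) hy]
  · intro x y h
    by_cases hy : y ∈ B
    · simp [hy, hBS y x (fun i hi => (h i hi).symm) hy]
    · simp [hy, mt (hBS x y h) hy]

theorem ae_infinitePi_of_forall [Countable ι] {p : X → Prop} (hp : ∀ᵐ x ∂ρ, p x) :
    ∀ᵐ x ∂(Measure.infinitePi fun _ : ι => ρ), ∀ i, p (x i) :=
  ae_all_iff.2 fun i => (measurePreserving_eval_infinitePi (fun _ : ι => ρ) i).quasiMeasurePreserving.ae hp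

end InfinitePi

/-- The law of the numbers of offspring. -/
abbrev offspringLaw (h : PMF ℕ) : Measure (List ℕ → ℕ) :=
  Measure.infinitePi fun _ : List ℕ => h.toMeasure

/-- The law of the biases. -/
abbrev biasLaw (ν : Measure ℝ) [IsProbabilityMeasure ν] : Measure (List ℕ → ℝ) :=
  Measure.infinitePi fun _ : List ℕ => ν

theorem measurable_zip :
    Measurable fun (p : (List ℕ → ℕ) × (List ℕ → ℝ)) (u : List ℕ) => (p.1 u, p.2 u) :=
  measurable_pi_lambda _ fun u => ((measurable_pi_apply u).comp measurable_fst).prodMk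
    ((measurable_pi_apply u).comp measurable_snd)

theorem measurable_gw : Measurable fun p : (List ℕ → ℕ) × (List ℕ → ℝ) => gw p.1 p.2 :=
  measurable_gwTree.comp measurable_zip

/-- Separating offspring from biases lets pruning alter the former while it merely relabels the
latter, which preserves their law. -/
theorem gwLaw_eq_map (h : PMF ℕ) (ν : Measure ℝ) [IsProbabilityMeasure ν] :
    gwLaw h ν = ((offspringLaw h).prod (biasLaw ν)).map fun p => gw p.1 p.2 := by
  have : ((offspringLaw h).prod (biasLaw ν)).map
      (fun (p : (List ℕ → ℕ) × (List ℕ → ℝ)) (u : List ℕ) => (p.1 u, p.2 u)) =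
      Measure.infinitePi fun _ : List ℕ => h.toMeasure.prod ν := by
    refine Measure.eq_infinitePi _ fun s t ht => ?_
    rw [Measure.map_apply measurable_zip (MeasurableSet.pi s.countable_toSet fun i _ => ht i)]
    let e := MeasurableEquiv.arrowProdEquivProdArrow ℕ ℝ s
    have he := measurePreserving_arrowProdEquivProdArrow ℕ ℝ s (fun _ => h.toMeasure) (fun _ => ν)
    have hr : ((offspringLaw h).prod (biasLaw ν)).map (Prod.map s.restrict s.restrict) =
        (Measure.pi fun _ : s => h.toMeasure).prod (Measure.pi fun _ : s => ν) := by
      rw [← Measure.map_prod_map _ _ (Finset.measurable_restrict s) (Finset.measurable_restrict s),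
        Measure.infinitePi_map_restrict, Measure.infinitePi_map_restrict]
    have ht' : MeasurableSet (Set.univ.pi fun i : s => t i) := .univ_pi fun i => ht i
    have hpre : (fun (p : (List ℕ → ℕ) × (List ℕ → ℝ)) (u : List ℕ) => (p.1 u, p.2 u)) ⁻¹'
        Set.pi s t = Prod.map s.restrict s.restrict ⁻¹' (e.symm ⁻¹' Set.univ.pi fun i : s => t i) := by
      ext p
      simp only [Set.mem_preimage, Set.mem_pi, Finset.mem_coe, Set.mem_univ, true_imp_iff,
        Subtype.forall]
      rfl
    rw [hpre, ← Measure.map_apply (by fun_prop) (e.symm.measurable ht'), hr,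
      he.symm.measure_preimage ht'.nullMeasurableSet, Measure.pi_pi, Finset.prod_coe_sort s fun i => (h.toMeasure.prod ν) (t i)]
  rw [gwLaw, ← this, Measure.map_map measurable_gwTree measurable_zip]
  rfl

/-! ### The size of an offshoot -/

theorem summable_mul_exp_neg {c : ℝ} (hc : 0 < c) :
    Summable fun k : ℕ => (k : ℝ) * Real.exp (-(c * k)) := by
  have := summable_pow_mul_geometric_of_norm_lt_one (R := ℝ) 1 (r := Real.exp (-c))
    (by rw [Real.norm_eq_abs, Real.abs_exp, Real.exp_lt_one_iff]; linarith)
  refine this.congr fun k => ?_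
  rw [pow_one, ← Real.exp_nat_mul]
  ring_nf

open Filter Topology in
/-- The generating function of a subcritical distribution with exponential tail lies strictly below
the diagonal somewhere to the right of `1`. -/
theorem exists_tsum_mul_pow_lt {h : PMF ℕ} (hmean : ∑' k : ℕ, (k : ℝ≥0∞) * h k < 1)
    (htail : ∃ c : ℝ, 0 < c ∧ ∀ k : ℕ, ∑' l : ℕ, h (k + l) ≤ ENNReal.ofReal (Real.exp (-(c * k)))) :
    ∃ s : ℝ≥0∞, 1 < s ∧ s ≠ ∞ ∧ ∑' k : ℕ, h k * s ^ k < s := by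
  obtain ⟨c, hc, htail⟩ := htail
  set p : ℕ → ℝ := fun k => (h k).toReal with hp
  have hp0 : ∀ k, 0 ≤ p k := fun k => ENNReal.toReal_nonneg
  have hpc : ∀ k, p k ≤ Real.exp (-(c * k)) := by
    intro k
    refine ENNReal.toReal_le_of_le_ofReal (Real.exp_pos _).le (le_trans ?_ (htail k))
    exact ENNReal.le_tsum (f := fun l => h (k + l)) 0
  have hof : ∀ k, h k = ENNReal.ofReal (p k) := fun k =>
    (ENNReal.ofReal_toReal (h.apply_ne_top k)).symm
  have hsum1 : HasSum p 1 := by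
    have := ENNReal.hasSum_toReal (f := h) (by rw [h.tsum_coe]; simp)
    rwa [← ENNReal.tsum_toReal_eq h.apply_ne_top, h.tsum_coe, ENNReal.toReal_one] at this
  have hmean' : ∑' k : ℕ, (k : ℝ) * p k < 1 := by
    have h1 : (∑' k : ℕ, (k : ℝ≥0∞) * h k).toReal = ∑' k : ℕ, (k : ℝ) * p k := by
      rw [ENNReal.tsum_toReal_eq fun k => ENNReal.mul_ne_top (by simp) (h.apply_ne_top k)]
      simp [hp]
    rw [← h1]
    simpa using (ENNReal.toReal_lt_toReal hmean.ne_top ENNReal.one_ne_top).2 hmean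
  -- Half of the exponential decay of `p` pays for `s ^ k`; the other half gives a summable majorant
  -- that is uniform in `s`.
  have hbound : ∀ s : ℝ, 0 ≤ s → s ≤ Real.exp (c / 2) → ∀ k : ℕ,
      (k : ℝ) * p k * s ^ k ≤ k * Real.exp (-(c / 2 * k)) := by
    intro s hs0 hs k
    have : p k * s ^ k ≤ Real.exp (-(c * k)) * Real.exp (c / 2) ^ k :=
      mul_le_mul (hpc k) (pow_le_pow_left₀ hs0 hs k) (by positivity) (Real.exp_pos _).le
    rw [← Real.exp_nat_mul, ← Real.exp_add] at this
    rw [mul_assoc]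
    refine mul_le_mul_of_nonneg_left (this.trans (Real.exp_le_exp.2 ?_)) (by positivity)
    ring_nf
    rfl
  have hS := summable_mul_exp_neg (half_pos hc)
  have h1exp : (1 : ℝ) < Real.exp (c / 2) := Real.one_lt_exp_iff.2 (half_pos hc)
  have hlim : Tendsto (fun s : ℝ => ∑' k : ℕ, (k : ℝ) * p k * s ^ k) (𝓝[>] 1)
      (𝓝 (∑' k : ℕ, (k : ℝ) * p k * 1 ^ k)) := by
    refine tendsto_tsum_of_dominated_convergence hS (fun k => ?_) ?_
    · exact ((continuous_const.mul (continuous_pow k)).tendsto 1).mono_left nhdsWithin_le_nhds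
    · filter_upwards [Ioo_mem_nhdsGT h1exp] with s hs k
      have h0 : 0 ≤ s := zero_le_one.trans hs.1.le
      rw [Real.norm_of_nonneg (by have := hp0 k; positivity)]
      exact hbound s h0 hs.2.le k
  simp only [one_pow, mul_one] at hlim
  obtain ⟨s, hs1, hs⟩ := ((hlim.eventually (gt_mem_nhds hmean')).and
    (Ioo_mem_nhdsGT h1exp)).exists
  have hs0 : 0 < s := zero_lt_one.trans hs.1
  have hsk : Summable fun k : ℕ => (k : ℝ) * p k * s ^ k :=
    Summable.of_nonneg_of_le (fun k => by have := hp0 k; positivity)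
      (hbound s hs0.le hs.2.le) hS
  -- Bernoulli's inequality for `1 / s`. Summed against `p`, it bounds the generating function by `1
  -- + (s - 1) * ∑ k p_k s^k`, and `s` is so close to `1` that the last sum is still below `1`.
  have hterm : ∀ k : ℕ, p k * s ^ k ≤ p k + (s - 1) * ((k : ℝ) * p k * s ^ k) := by
    intro k
    have hb : 1 + (k : ℝ) * (1 / s - 1) ≤ (1 / s) ^ k := by
      have := one_add_mul_le_pow (a := 1 / s - 1) (by have := one_div_pos.2 hs0; linarith) k
      simpa using this
    have hsp : 0 < s ^ k := pow_pos hs0 k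
    have h2 : s ^ k + (k : ℝ) * (1 / s - 1) * s ^ k ≤ 1 := by
      have := mul_le_mul_of_nonneg_right hb hsp.le
      rw [one_div, inv_pow, inv_mul_cancel₀ hsp.ne'] at this
      rw [one_div]
      linarith
    have h3 : -(s - 1) ≤ 1 / s - 1 := by
      rw [le_sub_iff_add_le, le_div_iff₀ hs0]
      nlinarith [hs.1]
    have h4 : s ^ k ≤ 1 + (s - 1) * ((k : ℝ) * s ^ k) := by
      have := mul_le_mul_of_nonneg_right h3 (by positivity : 0 ≤ (k : ℝ) * s ^ k)
      nlinarith
    have := mul_le_mul_of_nonneg_left h4 (hp0 k)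
    nlinarith
  have hsum : Summable fun k : ℕ => p k + (s - 1) * ((k : ℝ) * p k * s ^ k) :=
    hsum1.summable.add (hsk.mul_left _)
  have hsum' : Summable fun k : ℕ => p k * s ^ k :=
    Summable.of_nonneg_of_le (fun k => by have := hp0 k; positivity) hterm hsum
  have hlt : ∑' k : ℕ, p k * s ^ k < s := by
    calc ∑' k : ℕ, p k * s ^ k ≤ ∑' k : ℕ, (p k + (s - 1) * ((k : ℝ) * p k * s ^ k)) :=
          hsum'.tsum_le_tsum hterm hsum
      _ = 1 + (s - 1) * ∑' k : ℕ, (k : ℝ) * p k * s ^ k := by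
          rw [hsum1.summable.tsum_add (hsk.mul_left _), tsum_mul_left, hsum1.tsum_eq]
      _ < 1 + (s - 1) * 1 := by
          have := mul_lt_mul_of_pos_left hs1 (sub_pos.2 hs.1)
          linarith
      _ = s := by ring
  refine ⟨ENNReal.ofReal s, by simpa using hs.1, ENNReal.ofReal_ne_top, ?_⟩
  have : ∀ k, h k * ENNReal.ofReal s ^ k = ENNReal.ofReal (p k * s ^ k) := fun k => by
    rw [hof k, ENNReal.ofReal_mul (hp0 k), ENNReal.ofReal_pow hs0.le]
  rw [tsum_congr this, ← ENNReal.ofReal_tsum_of_nonneg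
    (fun k => by have := hp0 k; positivity) hsum', ENNReal.ofReal_lt_ofReal_iff hs0]
  exact hlt

/-! ### Exponential tilting and the size of an offshoot. -/

theorem offspring_eq_of_offshootVerts_eq {K K' : List ℕ → ℕ} (h : offshootVerts K = offshootVerts K')
    (hK : 0 < K []) (hK' : 0 < K' []) {r : List ℕ} (hr : r ∈ offshootVerts K) : K r = K' r := by
  have hr' : r ∈ offshootVerts K' := h ▸ hr
  have key : ∀ m, m < K r ↔ m < K' r := by
    intro m
    -- The child `[0]` of the root is the only child of a vertex of the offshoot that the vertex set
    -- does not record; positivity at the root supplies it.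
    by_cases h0 : [0] <+: r ++ [m]
    · rcases List.prefix_concat_iff.1 h0 with e | e
      · obtain ⟨rfl, rfl⟩ : r = [] ∧ m = 0 := by
          cases r with
          | nil => simpa [eq_comm] using e
          | cons x r => simp at e
        simp [hK, hK']
      · exact absurd e hr.2
    · have h1 : ∀ L : List ℕ → ℕ, r ∈ offshootVerts L → (m < L r ↔ r ++ [m] ∈ offshootVerts L) :=
        fun L hL => by
          rw [offshootVerts, Set.mem_ofPred_eq, concat_mem_gwVerts, and_iff_left h0,
            and_iff_right hL.1]
      rw [h1 K hr, h1 K' hr', h]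
  exact eq_of_forall_lt_iff key

/-- Each vertex other than the root is charged to its place among the children of its parent. The
root is charged to the place of the child `[0]`, which lies outside the offshoot. -/
theorem card_le_sum_offspring {K : List ℕ → ℕ} (hK : 0 < K []) {V : Finset (List ℕ)}
    (hV : offshootVerts K = V) : V.card ≤ ∑ r ∈ V, K r := by
  classical
  have hmem : ∀ r, r ∈ V ↔ r ∈ offshootVerts K := fun r => by rw [hV, Finset.mem_coe]
  have hsub : V ⊆ (V.sigma fun r => Finset.range (K r)).image fun x : (_ : List ℕ) × ℕ =>
      if x.1 = [] ∧ x.2 = 0 then [] else x.1 ++ [x.2] := by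
    intro r hr
    rw [Finset.mem_image]
    have hr' := (hmem r).1 hr
    induction r using List.reverseRecOn with
    | nil => exact ⟨⟨[], 0⟩, by simpa [hr] using hK, by simp⟩
    | append_singleton r m =>
      have h2 : ¬ [0] <+: r := fun h => hr'.2 (h.trans (List.prefix_append _ _))
      have h1 := concat_mem_gwVerts.1 hr'.1
      refine ⟨⟨r, m⟩, ?_, if_neg ?_⟩
      · rw [Finset.mem_sigma, hmem, Finset.mem_range]
        exact ⟨⟨h1.1, h2⟩, h1.2⟩
      · rintro ⟨h3, h4⟩
        dsimp only at h3 h4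
        subst h3 h4
        exact hr'.2 (by simp)
  calc V.card ≤ _ := (Finset.card_le_card hsub).trans Finset.card_image_le
    _ = ∑ r ∈ V, K r := by simp

theorem offspringLaw_cylinder (h : PMF ℕ) (V : Finset (List ℕ)) (K : List ℕ → ℕ) :
    offspringLaw h (Set.pi V fun r => {K r}) = ∏ r ∈ V, h (K r) := by
  rw [Measure.infinitePi_pi _ fun r _ => measurableSet_singleton _]
  exact Finset.prod_congr rfl fun r _ => h.toMeasure_apply_singleton _ (measurableSet_singleton _)

theorem setOf_offshootVerts_eq {K : List ℕ → ℕ} (hK : 0 < K []) {V : Finset (List ℕ)}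
    (hV : offshootVerts K = V) :
    {K' : List ℕ → ℕ | offshootVerts K' = V ∧ 0 < K' []} = Set.pi V fun r => {K r} := by
  have hnil : [] ∈ V := by
    rw [← Finset.mem_coe, ← hV]
    exact ⟨nil_mem_gwVerts _, by simp⟩
  ext K'
  simp only [Set.mem_ofPred_eq, Set.mem_pi, Finset.mem_coe, Set.mem_singleton_iff]
  constructor
  · rintro ⟨h1, h2⟩ r hr
    exact offspring_eq_of_offshootVerts_eq (h1.trans hV.symm) h2 hK (h1 ▸ hr)
  · intro hr
    refine ⟨(offshootVerts_eq_of_eqOn fun r h => hr r ?_).trans hV, by rwa [hr [] hnil]⟩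
    rwa [hV] at h

theorem measurableSet_offshootVerts_eq (V : Finset (List ℕ)) :
    MeasurableSet {K : List ℕ → ℕ | offshootVerts K = V ∧ 0 < K []} := by
  rcases {K : List ℕ → ℕ | offshootVerts K = V ∧ 0 < K []}.eq_empty_or_nonempty with
    h0 | ⟨K, hK1, hK2⟩
  · rw [h0]
    exact MeasurableSet.empty
  · rw [setOf_offshootVerts_eq hK2 hK1]
    exact MeasurableSet.pi V.countable_toSet fun _ _ => measurableSet_singleton _

theorem setOf_ncard_offshootVerts {k : ℕ} (hk : 0 < k) :
    {K : List ℕ → ℕ | (offshootVerts K).ncard = k ∧ 0 < K []} =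
      ⋃ V : {V : Finset (List ℕ) // V.card = k}, {K | offshootVerts K = V.1 ∧ 0 < K []} := by
  ext K
  simp only [Set.mem_ofPred_eq, Set.mem_iUnion]
  constructor
  · rintro ⟨h1, h2⟩
    have hfin : (offshootVerts K).Finite := Set.finite_of_ncard_pos (h1 ▸ hk)
    refine ⟨⟨hfin.toFinset, ?_⟩, ?_, h2⟩
    · rw [← h1, Set.ncard_eq_toFinset_card _ hfin]
    · simp
  · rintro ⟨V, h1, h2⟩
    exact ⟨by rw [h1, Set.ncard_coe_finset, V.2], h2⟩

theorem measurableSet_ncard_offshootVerts {k : ℕ} (hk : 0 < k) :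
    MeasurableSet {K : List ℕ → ℕ | (offshootVerts K).ncard = k ∧ 0 < K []} := by
  rw [setOf_ncard_offshootVerts hk]
  exact MeasurableSet.iUnion fun V => measurableSet_offshootVerts_eq _

/-- Tilt `h` by `s ^ k / f`, where `f < s` is the value of its generating function at `s`. An
offshoot with `k` vertices has offspring numbers that sum to at least `k`, so its probability under
`h` is at most `(f / s) ^ k` times that under the tilted law `g`. The sum over all offshoots of size
`k` of the latter is at most `1`. -/
theorem exists_offspringLaw_ncard_le {h : PMF ℕ} (hmean : ∑' k : ℕ, (k : ℝ≥0∞) * h k < 1)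
    (htail : ∃ c : ℝ, 0 < c ∧ ∀ k : ℕ, ∑' l : ℕ, h (k + l) ≤ ENNReal.ofReal (Real.exp (-(c * k)))) :
    ∃ ρ : ℝ≥0∞, ρ < 1 ∧ ∀ k : ℕ, 0 < k →
      offspringLaw h {K | (offshootVerts K).ncard = k ∧ 0 < K []} ≤ ρ ^ k := by
  obtain ⟨s, hs1, hs, hlt⟩ := exists_tsum_mul_pow_lt hmean htail
  have hs0 : s ≠ 0 := (zero_lt_one.trans hs1).ne'
  set f := ∑' k : ℕ, h k * s ^ k with hf
  have hftop : f ≠ ∞ := hlt.ne_top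
  have hf0 : f ≠ 0 := by
    intro h0
    rw [hf, ENNReal.tsum_eq_zero] at h0
    obtain ⟨k, hk⟩ := h.support_nonempty
    rcases mul_eq_zero.1 (h0 k) with h1 | h1
    · exact hk h1
    · exact pow_ne_zero k hs0 h1
  let g : PMF ℕ := PMF.normalize (fun k => h k * s ^ k) hf0 hftop
  have hg : ∀ k, h k = g k * f * (s ^ k)⁻¹ := by
    intro k
    rw [PMF.normalize_apply, mul_assoc (h k * s ^ k), ENNReal.inv_mul_cancel hf0 hftop, mul_one,
      mul_assoc, ENNReal.mul_inv_cancel (pow_ne_zero k hs0) (ENNReal.pow_ne_top hs), mul_one]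
  refine ⟨f / s, (ENNReal.div_lt_iff (Or.inl hs0) (Or.inl hs)).2 (by simpa using hlt),
    fun k hk => ?_⟩
  let E : Finset (List ℕ) → Set (List ℕ → ℕ) := fun V => {K | offshootVerts K = V ∧ 0 < K []}
  have hE : ∀ V, MeasurableSet (E V) := measurableSet_offshootVerts_eq
  have hbound : ∀ V : Finset (List ℕ), V.card = k →
      offspringLaw h (E V) ≤ (f / s) ^ k * offspringLaw g (E V) := by
    intro V hV
    rcases (E V).eq_empty_or_nonempty with h0 | ⟨K, hK1, hK2⟩
    · simp [h0]
    · have hEV : E V = Set.pi V fun r => {K r} := setOf_offshootVerts_eq hK2 hK1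
      have hsum := card_le_sum_offspring hK2 hK1
      rw [hEV, offspringLaw_cylinder, offspringLaw_cylinder]
      have h1 : ∏ r ∈ V, h (K r) = (∏ r ∈ V, g (K r)) * (f ^ k * ∏ r ∈ V, (s ^ K r)⁻¹) := by
        rw [Finset.prod_congr rfl fun r _ => hg (K r), Finset.prod_mul_distrib,
          Finset.prod_mul_distrib, Finset.prod_const, hV, mul_assoc]
      have h2 : ∏ r ∈ V, (s ^ K r)⁻¹ ≤ (s ^ k)⁻¹ := by
        simp only [ENNReal.inv_pow]
        rw [Finset.prod_pow_eq_pow_sum]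
        exact pow_le_pow_right_of_le_one' (ENNReal.inv_le_one.2 hs1.le) (hV ▸ hsum)
      rw [h1, mul_comm, div_eq_mul_inv, mul_pow, ← ENNReal.inv_pow]
      gcongr
  have hdisj : Pairwise (Function.onFun Disjoint
      fun V : {V : Finset (List ℕ) // V.card = k} => E V) := by
    intro V W hVW
    refine Set.disjoint_left.2 fun K hK hK' => hVW (Subtype.ext ?_)
    exact Finset.coe_injective (hK.1.symm.trans hK'.1)
  calc offspringLaw h {K | (offshootVerts K).ncard = k ∧ 0 < K []}
      ≤ ∑' V : {V : Finset (List ℕ) // V.card = k}, offspringLaw h (E V) :=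
        setOf_ncard_offshootVerts hk ▸ measure_iUnion_le _
    _ ≤ ∑' V : {V : Finset (List ℕ) // V.card = k}, (f / s) ^ k * offspringLaw g (E V) :=
        ENNReal.tsum_le_tsum fun V => hbound V V.2
    _ = (f / s) ^ k * offspringLaw g (⋃ V : {V : Finset (List ℕ) // V.card = k}, E V) := by
        rw [ENNReal.tsum_mul_left, measure_iUnion hdisj fun V => hE V]
    _ ≤ (f / s) ^ k * 1 := by gcongr; exact prob_le_one
    _ = (f / s) ^ k := mul_one _

/-! ### Prolongation and the Galton-Watson law -/

theorem measurableSet_setOf_gw_mem {B : Set WTree} (hB : MeasurableSet B) (K : List ℕ → ℕ) :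
    MeasurableSet {b : List ℕ → ℝ | gw K b ∈ B} :=
  measurable_gw.comp measurable_prodMk_left hB

theorem measurable_biasLaw_gw_mem (ν : Measure ℝ) [IsProbabilityMeasure ν] {B : Set WTree}
    (hB : MeasurableSet B) : Measurable fun K => biasLaw ν {b | gw K b ∈ B} :=
  measurable_measure_prodMk_left (measurable_gw hB)

theorem gwLaw_apply (h : PMF ℕ) (ν : Measure ℝ) [IsProbabilityMeasure ν] {B : Set WTree}
    (hB : MeasurableSet B) :
    gwLaw h ν B = ∫⁻ K, biasLaw ν {b | gw K b ∈ B} ∂offspringLaw h := by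
  rw [gwLaw_eq_map, Measure.map_apply measurable_gw hB, Measure.prod_apply (measurable_gw hB)]
  rfl

theorem ae_le_bias {ν : Measure ℝ} [IsProbabilityMeasure ν] {q Q : ℝ} (hν : ν (Set.Icc q Q)ᶜ = 0) :
    ∀ᵐ b ∂biasLaw ν, ∀ u, q ≤ b u :=
  ae_infinitePi_of_forall (ι := List ℕ) ν <|
    (ae_iff.2 hν : ∀ᵐ x ∂ν, x ∈ Set.Icc q Q).mono fun _ hx => hx.1

theorem ae_offspring_ne_zero (h : PMF ℕ) : ∀ᵐ K ∂offspringLaw h, ∀ u, h (K u) ≠ 0 := by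
  refine ae_infinitePi_of_forall (ι := List ℕ) (p := fun k => h k ≠ 0) h.toMeasure ?_
  rw [ae_iff, h.toMeasure_apply_eq_zero_iff MeasurableSet.of_discrete]
  exact Set.disjoint_left.2 fun x hx hx' => hx' hx

/-- The default tree for infinite vertex sets is a single vertex and has no spine. -/
theorem finite_of_spineLength_pos {κ : ℕ} {K : List ℕ → ℕ} {b : List ℕ → ℝ}
    (hs : 0 < (gw K b).spineLength κ) : (gwVerts K).Finite := by
  by_contra hK
  have h1 := (gw K b).vmax_mem
  rw [gw_verts_of_infinite hK, Finset.mem_singleton] at h1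
  simp [WTree.spineLength, h1] at hs

theorem measurable_totalWeight : Measurable WTree.totalWeight := by
  intro A hA
  have : WTree.totalWeight ⁻¹' A = ⋃ V : Finset (List ℕ), {T : WTree | T.verts = V} ∩
      (fun T : WTree => ∑ v ∈ V, T.weight v) ⁻¹' A := by
    ext T
    simp [WTree.totalWeight]
  rw [this]
  exact MeasurableSet.iUnion fun V => (measurableSet_verts fun W => W = V).inter
    (Finset.measurable_sum _ (fun v _ => measurable_weight v) hA)

/-! ### The cost of a prolongation. -/

/-- The trees with a given set of foliages and total weight exceeding `u / x`. -/
def foliageEvent (κ i : ℕ) (A : Set (AbsentFoliage i)) (x u : ℝ) : Set WTree :=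
  {T | absentFoliage κ i T ∈ A ∧ u < x * T.totalWeight}

theorem measurableSet_foliageEvent {κ i : ℕ} {A : Set (AbsentFoliage i)} (hA : MeasurableSet A)
    (x u : ℝ) : MeasurableSet (foliageEvent κ i A x u) :=
  (measurable_absentFoliage κ i hA).inter
    (measurableSet_lt measurable_const (measurable_totalWeight.const_mul x))

/-- The mean of `ν` serves as threshold: if there were no mass above it, the nonnegative variable `m
- x` would have integral zero, and `ν` would be the point mass at `m`. -/
theorem exists_pos_Iic_Ioi {ν : Measure ℝ} [IsProbabilityMeasure ν] {q Q : ℝ}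
    (hν : ν (Set.Icc q Q)ᶜ = 0) (hdeg : ∀ x : ℝ, ν ≠ Measure.dirac x) :
    ∃ x, ν (Set.Iic x) ≠ 0 ∧ ν (Set.Ioi x) ≠ 0 := by
  have hmem : ∀ᵐ x ∂ν, x ∈ Set.Icc q Q := ae_iff.2 hν
  have hint : Integrable (fun x : ℝ => x) ν :=
    Integrable.of_mem_Icc q Q measurable_id.aemeasurable hmem
  refine ⟨⨍ x, x ∂ν, (measure_le_average_pos (IsProbabilityMeasure.ne_zero ν) hint).ne', ?_⟩
  intro h0
  set m := ⨍ x, x ∂ν with hm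
  have hm' : m = ∫ x, x ∂ν := average_eq_integral ν _
  have hle : ∀ᵐ x ∂ν, x ≤ m := by
    rw [ae_iff]
    simp only [not_le]
    exact h0
  have hz : ∫ x, (m - x) ∂ν = 0 := by
    rw [integral_sub (integrable_const _) hint, ← hm']
    simp
  have heq : ∀ᵐ x ∂ν, m - x = 0 :=
    (integral_eq_zero_iff_of_nonneg_ae (hle.mono fun x hx => sub_nonneg.2 hx)
      ((integrable_const _).sub hint)).1 hz
  refine hdeg m ?_
  ext s hs
  rw [Measure.dirac_apply' _ hs]
  by_cases hms : m ∈ s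
  · have : ν s = 1 := by
      rw [← prob_compl_eq_zero_iff hs]
      refine measure_mono_null (fun x hx => ?_) heq
      exact fun h' => hx (by rwa [← sub_eq_zero.1 h'])
    simp [this, hms]
  · have : ν s = 0 := by
      refine measure_mono_null (fun x hx => ?_) heq
      exact fun h' => hms (by rwa [sub_eq_zero.1 h'])
    simp [this, hms]

theorem biasLaw_lt_ne_zero {ν : Measure ℝ} [IsProbabilityMeasure ν] {q Q : ℝ}
    (hν : ν (Set.Icc q Q)ᶜ = 0) {κ : ℕ} (hdeg : κ = 1 ∨ ∀ x : ℝ, ν ≠ Measure.dirac x) :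
    biasLaw ν {b | ∀ m ≠ 0, m < κ → b [m] < b [0]} ≠ 0 := by
  classical
  rcases hdeg with rfl | hdeg
  · have : {b : List ℕ → ℝ | ∀ m ≠ 0, m < 1 → b [m] < b [0]} = Set.univ :=
      Set.eq_univ_of_forall fun b m h1 h2 => by omega
    rw [this]
    simp
  · obtain ⟨x, hx1, hx2⟩ := exists_pos_Iic_Ioi hν hdeg
    let V : Finset (List ℕ) := (Finset.range (κ + 1)).image fun m => [m]
    let t : List ℕ → Set ℝ := fun u => if u = [0] then Set.Ioi x else Set.Iic x
    have ht : ∀ u, MeasurableSet (t u) := fun u => by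
      dsimp only [t]
      split_ifs
      · exact measurableSet_Ioi
      · exact measurableSet_Iic
    have hsub : Set.pi V t ⊆ {b | ∀ m ≠ 0, m < κ → b [m] < b [0]} := by
      intro b hb m hm hmκ
      have h1 := hb [m] (by simp [V]; omega)
      have h0 := hb [0] (by simp [V])
      simp only [t, List.cons.injEq, hm, and_true, if_false, Set.mem_Iic] at h1
      simp only [t, if_true, Set.mem_Ioi] at h0
      exact h1.trans_lt h0
    refine fun h0 => ?_
    have := measure_mono_null hsub h0
    rw [Measure.infinitePi_pi _ fun u _ => ht u, Finset.prod_eq_zero_iff] at this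
    obtain ⟨u, -, hu⟩ := this
    dsimp only [t] at hu
    split_ifs at hu
    · exact hx2 hu
    · exact hx1 hu

theorem offspringLaw_root_ne_zero {h : PMF ℕ} {κ : ℕ} (h0 : h 0 ≠ 0) (hκ : h κ ≠ 0) :
    offspringLaw h {K | K [] = κ ∧ ∀ m ≠ 0, m < κ → K [m] = 0} ≠ 0 := by
  classical
  let V : Finset (List ℕ) := insert [] ((Finset.range κ).image fun m => [m])
  let K₀ : List ℕ → ℕ := fun u => if u = [] then κ else 0
  have hsub : Set.pi V (fun u => {K₀ u}) ⊆
      {K : List ℕ → ℕ | K [] = κ ∧ ∀ m ≠ 0, m < κ → K [m] = 0} := by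
    intro K hK
    have h1 := hK [] (by simp [V])
    refine ⟨by simpa [K₀] using h1, fun m _ hm => ?_⟩
    have h2 := hK [m] (by simp [V, hm])
    simpa [K₀] using h2
  refine fun hz => ?_
  have := measure_mono_null hsub hz
  rw [offspringLaw_cylinder, Finset.prod_eq_zero_iff] at this
  obtain ⟨u, -, hu⟩ := this
  dsimp only [K₀] at hu
  split_ifs at hu
  · exact hκ hu
  · exact h0 hu

/-- The shift of labels that keeps the root. -/
def shiftLabel (u : List ℕ) : List ℕ := if u = [] then [] else 0 :: u

theorem shiftLabel_injective : Function.Injective shiftLabel := by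
  intro u v h
  unfold shiftLabel at h
  split_ifs at h <;> simp_all

/-- The factor `p` is the probability that the root and its children have the form of a
prolongation. This event is independent of the tree that sits at `[0]`, which is again a
Galton-Watson tree. -/
theorem gwLaw_foliageEvent_ge {h : PMF ℕ} {ν : Measure ℝ} [IsProbabilityMeasure ν] {q Q : ℝ}
    (hq : 1 < q) (hν : ν (Set.Icc q Q)ᶜ = 0) {κ : ℕ} (hκ0 : 0 < κ) (h0 : h 0 ≠ 0) (hκ : h κ ≠ 0)
    (hdeg : κ = 1 ∨ ∀ x : ℝ, ν ≠ Measure.dirac x) :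
    ∃ p : ℝ≥0∞, p ≠ 0 ∧ ∀ (i : ℕ) (A : Set (AbsentFoliage i)), MeasurableSet A →
      (∀ f ∈ A, i < f.1) → ∀ u : ℝ,
        p * gwLaw h ν (foliageEvent κ i A q u) ≤ gwLaw h ν (foliageEvent κ i A 1 u) := by
  set ΓK : Set (List ℕ → ℕ) := {K | K [] = κ ∧ ∀ m ≠ 0, m < κ → K [m] = 0} with hΓK
  set Γb : Set (List ℕ → ℝ) := {b | ∀ m ≠ 0, m < κ → b [m] < b [0]} with hΓb
  have hΓKm : MeasurableSet ΓK := by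
    refine MeasurableSet.inter (s₂ := {K : List ℕ → ℕ | ∀ m ≠ 0, m < κ → K [m] = 0})
      (measurableSet_eq_fun (measurable_pi_apply _) measurable_const) ?_
    simp only [Set.ofPred_forall]
    exact MeasurableSet.iInter fun m => MeasurableSet.iInter fun _ => MeasurableSet.iInter fun _ =>
      measurableSet_eq_fun (measurable_pi_apply _) measurable_const
  have hΓbm : MeasurableSet Γb := by
    simp only [hΓb, Set.ofPred_forall]
    exact MeasurableSet.iInter fun m => MeasurableSet.iInter fun _ => MeasurableSet.iInter fun _ =>
      measurableSet_lt (measurable_pi_apply _) (measurable_pi_apply _)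
  refine ⟨offspringLaw h ΓK * biasLaw ν Γb, mul_ne_zero (offspringLaw_root_ne_zero h0 hκ)
    (biasLaw_lt_ne_zero hν hdeg), fun i A hA hAi u => ?_⟩
  have hB := measurableSet_foliageEvent (κ := κ) hA q u
  have hB' := measurableSet_foliageEvent (κ := κ) hA 1 u
  have hF := measurable_biasLaw_gw_mem ν hB
  have hmap : ∀ e : List ℕ → List ℕ, Measurable fun (K : List ℕ → ℕ) => K ∘ e := fun e =>
    measurable_pi_lambda _ fun u => measurable_pi_apply (e u)
  have hmapb : ∀ e : List ℕ → List ℕ, Measurable fun (b : List ℕ → ℝ) => b ∘ e := fun e =>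
    measurable_pi_lambda _ fun u => measurable_pi_apply (e u)
  have hbias : ∀ K, K ∈ ΓK → biasLaw ν Γb * biasLaw ν {b | gw (K ∘ List.cons 0) b ∈
      foliageEvent κ i A q u} ≤ biasLaw ν {b | gw K b ∈ foliageEvent κ i A 1 u} := by
    intro K hK
    set C := {b | gw (K ∘ List.cons 0) b ∈ foliageEvent κ i A q u} with hC
    have hCm : MeasurableSet C := measurableSet_setOf_gw_mem hB _
    have h1 : biasLaw ν C = biasLaw ν ((fun b => b ∘ shiftLabel) ⁻¹' C) := by
      conv_lhs => rw [biasLaw, ← infinitePi_map_comp_injective ν shiftLabel_injective]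
      rw [Measure.map_apply (hmapb _) hCm]
    -- `Γb` reads labels of length one, and `shiftLabel` produces none: it sends nonempty labels to
    -- length at least two and fixes the root, whose bias has no effect on the weights.
    rw [h1, ← infinitePi_inter ν {u : List ℕ | u.length = 1} hΓbm (hmapb _ hCm)]
    · refine measure_mono_ae ?_
      filter_upwards [ae_le_bias hν] with b hb hbmem
      obtain ⟨hb1, hb2⟩ := hbmem
      change gw (K ∘ List.cons 0) (b ∘ shiftLabel) ∈ foliageEvent κ i A q u at hb2
      have hs : 0 < (gw (K ∘ List.cons 0) (b ∘ shiftLabel)).spineLength κ :=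
        (Nat.zero_le i).trans_lt (hAi _ hb2.1)
      have hpr := gw_isProlongation (b := b) (b' := b ∘ shiftLabel) hκ0 hK.1 hK.2
        (finite_of_spineLength_pos hs) (fun u hu => by simp [shiftLabel, hu]) hb1
      have hbT : ∀ u, 1 < (gw K b).bias u := fun u => by rw [gw_bias]; exact hq.trans_le (hb u)
      have hbT' : ∀ u, 1 < (gw (K ∘ List.cons 0) (b ∘ shiftLabel)).bias u := fun u => by
        rw [gw_bias]; exact hq.trans_le (hb _)
      refine ⟨?_, ?_⟩
      · rw [hpr.absentFoliage hbT hbT' hs i]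
        exact hb2.1
      · rw [one_mul]
        refine hb2.2.trans_le (le_trans ?_ (hpr.mul_totalWeight_le hbT))
        refine mul_le_mul_of_nonneg_right ?_
          (zero_le_one.trans (WTree.one_le_totalWeight hbT'))
        rw [gw_bias]
        exact hb _
    · intro x y hxy hx m hm hmκ
      rw [← hxy [m] rfl, ← hxy [0] rfl]
      exact hx m hm hmκ
    · intro x y hxy hx
      have : x ∘ shiftLabel = y ∘ shiftLabel := by
        funext u
        refine hxy _ ?_
        by_cases hu : u = []
        · simp [shiftLabel, hu]
        · simp [shiftLabel, hu]
      rw [Set.mem_preimage] at hx ⊢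
      rwa [← this]
  rw [gwLaw_apply h ν hB, gwLaw_apply h ν hB']
  have h2 : ∫⁻ K, biasLaw ν {b | gw K b ∈ foliageEvent κ i A q u} ∂offspringLaw h =
      ∫⁻ K, biasLaw ν {b | gw (K ∘ List.cons 0) b ∈ foliageEvent κ i A q u} ∂offspringLaw h := by
    conv_lhs => rw [offspringLaw, ← infinitePi_map_comp_injective h.toMeasure
      (List.cons_injective (a := 0))]
    rw [lintegral_map hF (hmap _)]
  have h3 := lintegral_infinitePi_mul h.toMeasure {u : List ℕ | ¬ [0] <+: u}
    (f := ΓK.indicator 1) (measurable_one.indicator hΓKm) (hF.comp (hmap (List.cons 0))) ?_ ?_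
  · rw [lintegral_indicator_one hΓKm] at h3
    calc offspringLaw h ΓK * biasLaw ν Γb *
          ∫⁻ K, biasLaw ν {b | gw K b ∈ foliageEvent κ i A q u} ∂offspringLaw h
        = biasLaw ν Γb * ∫⁻ K, ΓK.indicator 1 K *
          biasLaw ν {b | gw (K ∘ List.cons 0) b ∈ foliageEvent κ i A q u} ∂offspringLaw h := by
          rw [h2, mul_comm (offspringLaw h ΓK), mul_assoc]
          exact congrArg _ h3.symm
      _ = ∫⁻ K, biasLaw ν Γb * (ΓK.indicator 1 K *
          biasLaw ν {b | gw (K ∘ List.cons 0) b ∈ foliageEvent κ i A q u}) ∂offspringLaw h := by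
          rw [lintegral_const_mul]
          exact (measurable_one.indicator hΓKm).mul (hF.comp (hmap (List.cons 0)))
      _ ≤ _ := by
          refine lintegral_mono fun K => ?_
          by_cases hK : K ∈ ΓK
          · simpa [hK] using hbias K hK
          · simp [hK]
  · intro x y hxy
    have hmem : x ∈ ΓK ↔ y ∈ ΓK := by
      have e0 := hxy [] (by simp)
      have e1 : ∀ m ≠ 0, x [m] = y [m] := fun m hm => hxy [m] (by simpa [eq_comm] using hm)
      simp only [hΓK, Set.mem_ofPred_eq, e0]
      exact and_congr_right fun _ => forall₃_congr fun m hm _ => by rw [e1 m hm]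
    by_cases hy : y ∈ ΓK
    · simp [hy, hmem.2 hy]
    · simp [hy, mt hmem.1 hy]
  · intro x y hxy
    have : x ∘ List.cons 0 = y ∘ List.cons 0 := by
      funext u
      exact hxy _ (by simp)
    simp only [Function.comp_def] at this ⊢
    rw [this]

/-! ### Pruned offshoots -/

theorem finite_gwVerts_of_bounded {S : List ℕ → ℕ} {B : ℕ} (hB : ∀ r, S r ≤ B)
    (hS : ∀ r, 2 ≤ r.length → S r = 0) : (gwVerts S).Finite := by
  refine (((Set.finite_singleton []).union ((Set.finite_Iio B).image fun m => [m])).union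
    (((Set.finite_Iio B).prod (Set.finite_Iio B)).image fun p => [p.1, p.2])).subset ?_
  rintro r hr
  match r, hr with
  | [], _ => simp
  | [m], hr =>
    have h1 := singleton_mem_gwVerts.1 hr
    exact Or.inl (Or.inr ⟨m, h1.trans_le (hB _), rfl⟩)
  | [m, l], hr =>
    rw [cons_mem_gwVerts, singleton_mem_gwVerts] at hr
    exact Or.inr ⟨(m, l), ⟨hr.1.trans_le (hB _), hr.2.trans_le (hB _)⟩, rfl⟩
  | m :: l :: x :: r, hr =>
    rw [cons_mem_gwVerts, cons_mem_gwVerts, cons_mem_gwVerts] at hr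
    have := hr.2.2.1
    rw [hS _ (by simp)] at this
    omega

/-- A shape that a nonstandard offshoot can be pruned to: it codes finitely many vertices, has
positive probability, and its presence prevents the first child from being a standard vertex. -/
structure IsShape (h : PMF ℕ) (κ : ℕ) (S : List ℕ → ℕ) : Prop where
  pos : 0 < S []
  ne_zero : ∀ r, h (S r) ≠ 0
  finite : (offshootVerts S).Finite
  nonstandard : S [] ≠ κ ∨ ∃ l ≠ 0, l < S [] ∧ S [l] ≠ 0

/-- There are two kinds of shapes: a root with `n` children, where `n` is the least possible
offspring number above `κ`, and a root with `κ` children of which one, other than `0`, has `κ`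
children. If a root has exactly `κ` children and those other than `0` are childless, its offshoot
has only `κ` vertices, so a larger one dominates some shape. -/
theorem exists_shapes {h : PMF ℕ} {κ : ℕ} (hκ0 : 0 < κ) (h0 : h 0 ≠ 0) (hκ : h κ ≠ 0)
    (hmin : ∀ l, 0 < l → h l ≠ 0 → κ ≤ l) :
    ∃ F : Finset (List ℕ → ℕ), (∀ S ∈ F, IsShape h κ S) ∧
      ∀ N : List ℕ → ℕ, (∀ r, h (N r) ≠ 0) → 0 < N [] → κ < (offshootVerts N).ncard →
        ∃ S ∈ F, ∀ r, ¬ [0] <+: r → S r ≤ N r := by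
  classical
  let S₀ : ℕ → List ℕ → ℕ := fun n r => if r = [] then n else 0
  let S₁ : ℕ → List ℕ → ℕ := fun l r => if r = [] ∨ r = [l] then κ else 0
  have hS₀ : ∀ n, κ < n → h n ≠ 0 → IsShape h κ (S₀ n) := by
    intro n hn hn0
    refine ⟨?_, fun r => ?_, ?_, Or.inl ?_⟩
    · simp only [S₀, if_true]; omega
    · dsimp only [S₀]; split_ifs <;> assumption
    · refine (finite_gwVerts_of_bounded (B := n) (fun r => ?_) fun r hr => ?_).subset fun r hr => hr.1
      · dsimp only [S₀]; split_ifs <;> omega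
      · exact if_neg (by rintro rfl; simp at hr)
    · simp only [S₀, if_true]; omega
  have hS₁ : ∀ l, l ≠ 0 → l < κ → IsShape h κ (S₁ l) := by
    intro l hl hlκ
    refine ⟨?_, fun r => ?_, ?_, Or.inr ⟨l, hl, ?_, ?_⟩⟩
    · simpa [S₁] using hκ0
    · dsimp only [S₁]; split_ifs <;> assumption
    · refine (finite_gwVerts_of_bounded (B := κ) (fun r => ?_) fun r hr => ?_).subset fun r hr => hr.1
      · dsimp only [S₁]; split_ifs <;> omega
      · exact if_neg (by rintro (rfl | rfl) <;> simp at hr)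
    · simpa [S₁] using hlκ
    · simpa [S₁] using hκ0.ne'
  have hcase : ∀ N : List ℕ → ℕ, (∀ r, h (N r) ≠ 0) → 0 < N [] → κ < (offshootVerts N).ncard →
      κ < N [] ∨ ∃ l ≠ 0, l < κ ∧ ∀ r, ¬ [0] <+: r → S₁ l r ≤ N r := by
    intro N hN hpos hcard
    rcases (hmin _ hpos (hN [])).lt_or_eq with hlt | heq
    · exact Or.inl hlt
    refine Or.inr ?_
    have : ∃ l ≠ 0, l < κ ∧ N [l] ≠ 0 := by
      by_contra! hno
      have hsub : offshootVerts N ⊆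
          ((Finset.range κ).image fun m => if m = 0 then [] else [m] : Finset (List ℕ)) := by
        rintro r ⟨hr1, hr2⟩
        rw [Finset.mem_coe, Finset.mem_image]
        match r, hr1, hr2 with
        | [], _, _ => exact ⟨0, by simpa using hκ0, by simp⟩
        | [m], hr1, hr2 =>
          have hm : m ≠ 0 := by rintro rfl; simp at hr2
          rw [singleton_mem_gwVerts, ← heq] at hr1
          exact ⟨m, by simpa using hr1, by simp [hm]⟩
        | m :: l :: r, hr1, hr2 =>
          have hm : m ≠ 0 := by rintro rfl; simp at hr2
          rw [cons_mem_gwVerts, cons_mem_gwVerts, ← heq] at hr1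
          have := hr1.2.1
          rw [hno m hm hr1.1] at this
          omega
      have h1 := Set.ncard_le_ncard hsub (Finset.finite_toSet _)
      rw [Set.ncard_coe_finset] at h1
      have h2 := Finset.card_image_le (s := Finset.range κ)
        (f := fun m => if m = 0 then [] else [m])
      rw [Finset.card_range] at h2
      omega
    obtain ⟨l, hl, hlκ, hNl⟩ := this
    refine ⟨l, hl, hlκ, fun r _ => ?_⟩
    dsimp only [S₁]
    split_ifs with hr
    · rcases hr with rfl | rfl
      · exact heq.le
      · exact hmin _ (Nat.pos_of_ne_zero hNl) (hN _)
    · exact Nat.zero_le _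
  let F₁ : Finset (List ℕ → ℕ) := ((Finset.range κ).filter (· ≠ 0)).image S₁
  have hF₁ : ∀ S ∈ F₁, IsShape h κ S := by
    intro S hS
    obtain ⟨l, hl, rfl⟩ := Finset.mem_image.1 hS
    rw [Finset.mem_filter, Finset.mem_range] at hl
    exact hS₁ l hl.2 hl.1
  by_cases hex : ∃ n, κ < n ∧ h n ≠ 0
  · refine ⟨insert (S₀ (Nat.find hex)) F₁, fun S hS => ?_, fun N hN hpos hcard => ?_⟩
    · rcases Finset.mem_insert.1 hS with rfl | hS
      · exact hS₀ _ (Nat.find_spec hex).1 (Nat.find_spec hex).2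
      · exact hF₁ S hS
    · rcases hcase N hN hpos hcard with hlt | ⟨l, hl, hlκ, hle⟩
      · refine ⟨_, Finset.mem_insert_self _ _, fun r _ => ?_⟩
        dsimp only [S₀]
        split_ifs with hr
        · rw [hr]
          exact Nat.find_min' hex ⟨hlt, hN []⟩
        · exact Nat.zero_le _
      · exact ⟨S₁ l, Finset.mem_insert_of_mem
          (Finset.mem_image_of_mem _ (by simp [hl, hlκ])), hle⟩
  · refine ⟨F₁, hF₁, fun N hN hpos hcard => ?_⟩
    rcases hcase N hN hpos hcard with hlt | ⟨l, hl, hlκ, hle⟩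
    · exact absurd ⟨_, hlt, hN []⟩ hex
    · exact ⟨S₁ l, Finset.mem_image_of_mem _ (by simp [hl, hlκ]), hle⟩

theorem not_isStandard_gw {κ : ℕ} {K : List ℕ → ℕ} {b : List ℕ → ℝ} {a : List ℕ}
    (hK : (gwVerts K).Finite) (ha : a ∈ gwVerts K)
    (hns : K a ≠ κ ∨ ∃ l ≠ 0, l < K a ∧ K (a ++ [l]) ≠ 0) :
    ¬ IsStandard κ (gw K b) (a ++ [0]) := by
  intro hst
  obtain ⟨h1, h2⟩ := hst a 0 List.prefix_rfl
  have hch : (gw K b).children a = (fun m => a ++ [m]) '' (Finset.range (K a) : Set ℕ) := by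
    ext w
    constructor
    · rintro ⟨hw, m, rfl⟩
      rw [mem_gw_verts hK, concat_mem_gwVerts] at hw
      exact ⟨m, by simpa using hw.2, rfl⟩
    · rintro ⟨m, hm, rfl⟩
      refine ⟨?_, m, rfl⟩
      rw [mem_gw_verts hK, concat_mem_gwVerts]
      exact ⟨ha, by simpa using hm⟩
  rcases hns with h | ⟨l, hl, hlK, hne⟩
  · rw [hch, Set.ncard_image_of_injective _ (fun x y hxy => by simpa using hxy)] at h1
    simp at h1
    exact h h1
  · have hw : a ++ [l] ∈ (gw K b).children a := by
      rw [hch]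
      exact ⟨l, by simpa using hlK, rfl⟩
    have := (h2 _ hw (by simpa using hl)).1
    rw [Set.eq_empty_iff_forall_notMem] at this
    refine this (a ++ [l] ++ [0]) ⟨?_, 0, rfl⟩
    rw [mem_gw_verts hK, concat_mem_gwVerts, concat_mem_gwVerts]
    exact ⟨⟨ha, hlK⟩, Nat.pos_of_ne_zero hne⟩

/-- The root stands in for its missing child `[0]`. This bounds the number of possible labels `j` of
the spine child by the size of the offshoot. -/
theorem root_le_ncard_offshootVerts {N : List ℕ → ℕ} (hfin : (offshootVerts N).Finite) :
    N [] ≤ (offshootVerts N).ncard := by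
  have hinj : Function.Injective fun m : ℕ => if m = 0 then ([] : List ℕ) else [m] := by
    intro x y hxy
    dsimp only at hxy
    split_ifs at hxy <;> simp_all
  have hsub : (fun m : ℕ => if m = 0 then ([] : List ℕ) else [m]) '' (Finset.range (N []) : Set ℕ) ⊆
      offshootVerts N := by
    rintro _ ⟨m, hm, rfl⟩
    dsimp only
    split_ifs with h0
    · exact ⟨nil_mem_gwVerts _, by simp⟩
    · exact ⟨singleton_mem_gwVerts.2 (by simpa using hm), by simpa [eq_comm] using h0⟩
  have := Set.ncard_le_ncard hsub hfin
  rw [Set.ncard_image_of_injective _ hinj] at this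
  simpa using this

/-- The trees whose spine passes from `a` to `a ++ [j]` in step `i`, and then to the maximal vertex
`a ++ j :: t`. -/
def spineEvent (κ i : ℕ) (a : List ℕ) (j : ℕ) (t : List ℕ) : Set WTree :=
  {T | T.vmax = a ++ j :: t ∧ T.fbpDepth κ = a.length - i}

theorem measurableSet_spineEvent (κ i : ℕ) (a : List ℕ) (j : ℕ) (t : List ℕ) :
    MeasurableSet (spineEvent κ i a j t) := measurableSet_vmax_fbpDepth _ _ _

theorem offshoot_eq_branch_take {κ d : ℕ} {T : WTree} {v : List ℕ} (i : ℕ) (hv : T.vmax = v)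
    (hd : T.fbpDepth κ = d) :
    T.offshoot κ i = T.branch (v.take (d + i)) (v.take (d + (i + 1))) := by
  rw [WTree.offshoot, WTree.spineVertex, WTree.spineVertex, hv, hd]

theorem measurableSet_card_offshoot (κ i k : ℕ) :
    MeasurableSet {T : WTree | (T.offshoot κ i).verts.card = k} := by
  have : {T : WTree | (T.offshoot κ i).verts.card = k} = ⋃ v : List ℕ, ⋃ d : ℕ,
      ({T | T.vmax = v ∧ T.fbpDepth κ = d} ∩
        (fun T : WTree => T.branch (v.take (d + i)) (v.take (d + (i + 1)))) ⁻¹'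
          {T | T.verts.card = k}) := by
    ext T
    simp only [Set.mem_iUnion, Set.mem_inter_iff, Set.mem_preimage, Set.mem_ofPred_eq]
    constructor
    · intro h
      rw [offshoot_eq_branch_take i rfl rfl] at h
      exact ⟨_, _, ⟨rfl, rfl⟩, h⟩
    · rintro ⟨v, d, ⟨hv, hd⟩, h⟩
      rwa [offshoot_eq_branch_take i hv hd]
  rw [this]
  exact MeasurableSet.iUnion fun v => MeasurableSet.iUnion fun d =>
    (measurableSet_vmax_fbpDepth κ v d).inter
      (measurable_branch _ _ (measurableSet_verts fun V => V.card = k))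

/-- Pruning an offshoot of a Galton-Watson tree. -/
theorem gw_modify_mem {h : PMF ℕ} {κ i k j : ℕ} {A : Set (AbsentFoliage i)} {u : ℝ} {a t : List ℕ}
    (hai : i ≤ a.length) {K S : List ℕ → ℕ} {b : List ℕ → ℝ} (hb : ∀ u, 1 < b u)
    (hK : (gwVerts K).Finite) (hj : j < K a) (hS : IsShape h κ S)
    (hSK : ∀ r, ¬ [0] <+: r → S r ≤ K (swapAt a j (a ++ r)))
    (hT : gw K b ∈ spineEvent κ i a j t) (hT' : gw K b ∈ foliageEvent κ i A 1 u)
    (hcard : ((gw K b).offshoot κ i).verts.card = k) :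
    gw (modify a S (K ∘ swapAt a j)) (b ∘ swapAt a j) ∈
      spineEvent κ i a 0 t ∩ foliageEvent κ i A k u := by
  have H := gw_isPruning b hj hK hS.pos hSK
  have hlen : a.length = (a.length - i) + i := by omega
  have hv := H.vmax hT.1
  -- The default tree consists of the root alone, whereas the maximal vertex here is `a ++ 0 :: t`.
  have hfin : (gwVerts (modify a S (K ∘ swapAt a j))).Finite := by
    by_contra hinf
    have h1 := (gw (modify a S (K ∘ swapAt a j)) (b ∘ swapAt a j)).vmax_mem
    rw [hv, gw_verts_of_infinite hinf] at h1
    simp at h1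
  have ha : a ∈ gwVerts (modify a S (K ∘ swapAt a j)) := by
    rw [← mem_gw_verts hfin (b := b ∘ swapAt a j)]
    refine WTree.mem_of_prefix _ (WTree.vmax_mem _) ?_
    rw [hv]
    exact List.prefix_append _ _
  have hns : ¬ IsStandard κ (gw (modify a S (K ∘ swapAt a j)) (b ∘ swapAt a j)) (a ++ [0]) := by
    refine not_isStandard_gw hfin ha ?_
    rw [modify_self]
    refine hS.nonstandard.imp_right ?_
    rintro ⟨l, hl, h1, h2⟩
    refine ⟨l, hl, h1, ?_⟩
    rwa [modify_append]
    simpa [eq_comm] using hl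
  refine ⟨⟨hv, H.fbpDepth hT.1 hlen hT.2 fun _ => hns⟩, ?_, ?_⟩
  · rw [← H.absentFoliage hT.1 hlen hT.2 fun _ => hns]
    exact hT'.1
  · have := H.totalWeight_le hT.1 hlen hT.2 fun u => by rw [gw_bias]; exact hb u
    rw [hcard] at this
    have h2 := hT'.2
    rw [one_mul] at h2
    exact h2.trans_le this

/-! ### Pruning and the Galton-Watson law -/

theorem measurable_comp_label {X : Type*} [MeasurableSpace X] (e : List ℕ → List ℕ) :
    Measurable fun K : List ℕ → X => K ∘ e :=
  measurable_pi_lambda _ fun u => measurable_pi_apply (e u)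

theorem measurable_modify (a : List ℕ) (S : List ℕ → ℕ) : Measurable (modify a S) := by
  refine measurable_pi_lambda _ fun u => ?_
  by_cases hu : u ∈ offLabels a
  · simp only [modify, hu, if_true]
    exact measurable_const
  · simp only [modify, hu, if_false]
    exact measurable_pi_apply u

/-! ### Independence of an offshoot from the rest of the tree. -/

/-- The families of numbers of offspring with `k` vertices in the part of the tree below `a` outside
of the subtree at `a ++ [0]`. -/
def sizeEvent (a : List ℕ) (k : ℕ) : Set (List ℕ → ℕ) :=
  {K | (offshootVerts (K ∘ (a ++ ·))).ncard = k ∧ 0 < K a}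

theorem sizeEvent_eq_preimage (a : List ℕ) (k : ℕ) :
    sizeEvent a k = (fun K : List ℕ → ℕ => K ∘ (a ++ ·)) ⁻¹'
      {K | (offshootVerts K).ncard = k ∧ 0 < K []} := by
  ext K
  simp [sizeEvent]

theorem measurableSet_sizeEvent (a : List ℕ) {k : ℕ} (hk : 0 < k) :
    MeasurableSet (sizeEvent a k) := by
  rw [sizeEvent_eq_preimage]
  exact measurable_comp_label _ (measurableSet_ncard_offshootVerts hk)

theorem offspringLaw_sizeEvent (h : PMF ℕ) (a : List ℕ) {k : ℕ} (hk : 0 < k) :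
    offspringLaw h (sizeEvent a k) =
      offspringLaw h {K | (offshootVerts K).ncard = k ∧ 0 < K []} := by
  rw [sizeEvent_eq_preimage, ← Measure.map_apply (measurable_comp_label _)
    (measurableSet_ncard_offshootVerts hk), offspringLaw,
    infinitePi_map_comp_injective h.toMeasure (List.append_right_injective a)]

theorem mem_sizeEvent_of_eqOn {a : List ℕ} {k : ℕ} {x y : List ℕ → ℕ}
    (hxy : ∀ u ∈ offLabels a, x u = y u) (hx : x ∈ sizeEvent a k) : y ∈ sizeEvent a k := by
  have hoff : offshootVerts (y ∘ (a ++ ·)) = offshootVerts (x ∘ (a ++ ·)) :=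
    offshootVerts_eq_of_eqOn fun r hr => (hxy _ (append_mem_offLabels.2 hr.2)).symm
  refine ⟨by rw [hoff]; exact hx.1, ?_⟩
  rw [← hxy a (by simpa using append_mem_offLabels (a := a) (r := []))]
  exact hx.2

/-- The probability that a tree has a prescribed offshoot, conditionally on its existence. -/
def shapeProb (h : PMF ℕ) (S : List ℕ → ℕ) : ℝ≥0∞ :=
  offspringLaw h {K | ∀ r ∈ offshootVerts S, K r = S r}

theorem IsShape.measurableSet {h : PMF ℕ} {κ : ℕ} {S : List ℕ → ℕ} (hS : IsShape h κ S) :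
    MeasurableSet {K : List ℕ → ℕ | ∀ r ∈ offshootVerts S, K r = S r} := by
  have : {K : List ℕ → ℕ | ∀ r ∈ offshootVerts S, K r = S r} =
      Set.pi (offshootVerts S) fun r => {S r} := by ext K; simp
  rw [this]
  exact MeasurableSet.pi hS.finite.countable fun _ _ => measurableSet_singleton _

theorem IsShape.shapeProb_ne_zero {h : PMF ℕ} {κ : ℕ} {S : List ℕ → ℕ} (hS : IsShape h κ S) :
    shapeProb h S ≠ 0 := by
  have : {K : List ℕ → ℕ | ∀ r ∈ offshootVerts S, K r = S r} =
      Set.pi hS.finite.toFinset fun r => {S r} := by ext K; simp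
  rw [shapeProb, this, offspringLaw_cylinder]
  exact Finset.prod_ne_zero_iff.2 fun r _ => hS.ne_zero _

/-- The modified tree does not read the labels in `offLabels a`, so it is independent of the event
that the offshoot already has shape `S`; on this event the modification has no effect. -/
theorem shapeProb_mul_le {h : PMF ℕ} {ν : Measure ℝ} [IsProbabilityMeasure ν] {κ : ℕ}
    {S : List ℕ → ℕ} (hS : IsShape h κ S) (a : List ℕ) {B : Set WTree} (hB : MeasurableSet B) :
    shapeProb h S * ∫⁻ K, biasLaw ν {b | gw (modify a S K) b ∈ B} ∂offspringLaw h ≤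
      gwLaw h ν B := by
  set Γ : Set (List ℕ → ℕ) := (fun K => K ∘ (a ++ ·)) ⁻¹' {K | ∀ r ∈ offshootVerts S, K r = S r}
    with hΓ
  have hΓm : MeasurableSet Γ := measurable_comp_label _ hS.measurableSet
  have hF := (measurable_biasLaw_gw_mem ν hB).comp (measurable_modify a S)
  have hprob : offspringLaw h Γ = shapeProb h S := by
    rw [hΓ, ← Measure.map_apply (measurable_comp_label _) hS.measurableSet, offspringLaw,
      infinitePi_map_comp_injective h.toMeasure (List.append_right_injective a)]
    rfl
  have hprod := lintegral_infinitePi_mul h.toMeasure (offLabels a) (f := Γ.indicator 1)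
    (measurable_one.indicator hΓm) hF ?_ ?_
  · rw [lintegral_indicator_one hΓm] at hprod
    rw [← hprob, gwLaw_apply h ν hB]
    refine hprod.symm.trans_le (lintegral_mono fun K => ?_)
    by_cases hK : K ∈ Γ
    · simp only [hK, Set.indicator_of_mem, Pi.one_apply, one_mul, Function.comp_apply]
      refine measure_mono fun b hb => ?_
      rwa [Set.mem_ofPred_eq, gw_congr (gwVerts_modify_eq hK)] at hb
    · simp [hK]
  · intro x y hxy
    have key : ∀ x y : List ℕ → ℕ, (∀ u ∈ offLabels a, x u = y u) → x ∈ Γ → y ∈ Γ :=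
      fun x y hxy hx r hr => (hxy (a ++ r) (append_mem_offLabels.2 hr.2)).symm.trans (hx r hr)
    by_cases hy : y ∈ Γ
    · simp [hy, key y x (fun u hu => (hxy u hu).symm) hy]
    · simp [hy, mt (key x y hxy) hy]
  · intro x y hxy
    have : modify a S x = modify a S y := by
      funext u
      by_cases hu : u ∈ offLabels a
      · simp [modify, hu]
      · simp [modify, hu, hxy u hu]
    simp only [Function.comp_apply, this]

theorem lintegral_sizeEvent_mul (h : PMF ℕ) (ν : Measure ℝ) [IsProbabilityMeasure ν]
    (S : List ℕ → ℕ) (a : List ℕ) {k : ℕ} (hk : 0 < k) {B : Set WTree} (hB : MeasurableSet B) :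
    ∫⁻ K, (sizeEvent a k).indicator 1 K * biasLaw ν {b | gw (modify a S K) b ∈ B}
        ∂offspringLaw h =
      offspringLaw h (sizeEvent a k) *
        ∫⁻ K, biasLaw ν {b | gw (modify a S K) b ∈ B} ∂offspringLaw h := by
  have hF := (measurable_biasLaw_gw_mem ν hB).comp (measurable_modify a S)
  have hm := measurableSet_sizeEvent a hk
  rw [← lintegral_indicator_one hm]
  refine lintegral_infinitePi_mul h.toMeasure (offLabels a) (measurable_one.indicator hm) hF ?_ ?_
  · intro x y hxy
    by_cases hy : y ∈ sizeEvent a k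
    · simp [hy, mem_sizeEvent_of_eqOn (fun u hu => (hxy u hu).symm) hy]
    · simp [hy, mt (mem_sizeEvent_of_eqOn hxy) hy]
  · intro x y hxy
    have : modify a S x = modify a S y := by
      funext u
      by_cases hu : u ∈ offLabels a
      · simp [modify, hu]
      · simp [modify, hu, hxy u hu]
    simp only [this]

/-! ### The pruning inequality. -/

/-- The event that is estimated by pruning. -/
def largeOffshootEvent (κ i k : ℕ) (A : Set (AbsentFoliage i)) (u : ℝ) : Set WTree :=
  foliageEvent κ i A 1 u ∩ {T | (T.offshoot κ i).verts.card = k}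

/-- Which shape applies depends on `K`, so the bound sums over all of them. The right-hand side is a
function of the swapped family, which has the same law as `K`. -/
theorem biasLaw_le_sum_shapes {h : PMF ℕ} {ν : Measure ℝ} [IsProbabilityMeasure ν] {q Q : ℝ}
    (hq : 1 < q) (hν : ν (Set.Icc q Q)ᶜ = 0) {κ : ℕ} {F : Finset (List ℕ → ℕ)}
    (hF : ∀ S ∈ F, IsShape h κ S)
    (hF' : ∀ N : List ℕ → ℕ, (∀ r, h (N r) ≠ 0) → 0 < N [] → κ < (offshootVerts N).ncard →
        ∃ S ∈ F, ∀ r, ¬ [0] <+: r → S r ≤ N r)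
    {i k : ℕ} (hk : κ < k) {A : Set (AbsentFoliage i)} (hA : MeasurableSet A) (u : ℝ)
    {a : List ℕ} (hai : i ≤ a.length) (j : ℕ) (t : List ℕ) {K : List ℕ → ℕ}
    (hKh : ∀ u, h (K u) ≠ 0) :
    biasLaw ν {b | gw K b ∈ spineEvent κ i a j t ∩ largeOffshootEvent κ i k A u} ≤
      ∑ S ∈ F, {L : List ℕ → ℕ | j < L a}.indicator 1 (K ∘ swapAt a j) *
        ((sizeEvent a k).indicator 1 (K ∘ swapAt a j) *
        biasLaw ν {b | gw (modify a S (K ∘ swapAt a j)) b ∈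
          spineEvent κ i a 0 t ∩ foliageEvent κ i A k u}) := by
  -- One sample `b₀` of biases in the event suffices to derive the properties of `K` that do not
  -- involve the biases.
  rcases {b | gw K b ∈ spineEvent κ i a j t ∩ largeOffshootEvent κ i k A u}.eq_empty_or_nonempty
    with hemp | ⟨b₀, hb₁, hb₂, hb₃⟩
  · rw [hemp, measure_empty]
    exact zero_le
  have hlen : a.length = (a.length - i) + i := by omega
  have hfin : (gwVerts K).Finite := by
    refine finite_of_spineLength_pos (κ := κ) (b := b₀) ?_
    rw [WTree.spineLength, hb₁.1, hb₁.2, List.length_append, List.length_cons]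
    omega
  have hv : a ++ j :: t ∈ gwVerts K := by
    rw [← hb₁.1, ← mem_gw_verts hfin]
    exact WTree.vmax_mem _
  have haK : a ∈ gwVerts K := (append_mem_gwVerts.1 hv).1
  have hj : j < K a := by
    have := (cons_mem_gwVerts.1 (append_mem_gwVerts.1 hv).2).1
    simpa using this
  have hcard : (offshootVerts ((K ∘ swapAt a j) ∘ (a ++ ·))).ncard = k := by
    rw [← hb₃, IsPruning.offshoot_eq_branch hb₁.1 hlen hb₁.2, card_branch_gw b₀ haK hj hfin]
    rfl
  have hKa : (K ∘ swapAt a j) a = K a := by rw [Function.comp_apply, swapAt_self]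
  have hsize : K ∘ swapAt a j ∈ sizeEvent a k := ⟨hcard, by rw [hKa]; omega⟩
  obtain ⟨S, hSF, hSK⟩ := hF' ((K ∘ swapAt a j) ∘ (a ++ ·)) (fun r => hKh _)
    (by simpa using hsize.2) (by rw [hcard]; exact hk)
  have hB : MeasurableSet (spineEvent κ i a 0 t ∩ foliageEvent κ i A k u) :=
    (measurableSet_spineEvent κ i a 0 t).inter (measurableSet_foliageEvent hA _ u)
  refine le_trans ?_ (Finset.single_le_sum
    (f := fun S => {L : List ℕ → ℕ | j < L a}.indicator 1 (K ∘ swapAt a j) *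
        ((sizeEvent a k).indicator 1 (K ∘ swapAt a j) *
        biasLaw ν {b | gw (modify a S (K ∘ swapAt a j)) b ∈
          spineEvent κ i a 0 t ∩ foliageEvent κ i A k u})) (fun _ _ => zero_le) hSF)
  have hjm : K ∘ swapAt a j ∈ {L : List ℕ → ℕ | j < L a} := by
    rw [Set.mem_ofPred_eq, hKa]
    exact hj
  simp only [hsize, hjm, Set.indicator_of_mem, Pi.one_apply, one_mul]
  set C := {b | gw (modify a S (K ∘ swapAt a j)) b ∈
          spineEvent κ i a 0 t ∩ foliageEvent κ i A k u} with hC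
  have hCm : MeasurableSet C := measurableSet_setOf_gw_mem hB _
  have h1 : biasLaw ν C = biasLaw ν ((fun b => b ∘ swapAt a j) ⁻¹' C) := by
    conv_lhs => rw [biasLaw, ← infinitePi_map_comp_injective ν (swapAt_injective a j)]
    rw [Measure.map_apply (measurable_comp_label _) hCm]
  rw [h1]
  refine measure_mono_ae ?_
  filter_upwards [ae_le_bias hν] with b hb hbmem
  exact gw_modify_mem hai (fun u => hq.trans_le (hb u)) hfin hj (hF S hSF) hSK hbmem.1 hbmem.2.1
    hbmem.2.2

theorem gwLaw_spineEvent_le {h : PMF ℕ} {ν : Measure ℝ} [IsProbabilityMeasure ν] {q Q : ℝ}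
    (hq : 1 < q) (hν : ν (Set.Icc q Q)ᶜ = 0) {κ : ℕ} {F : Finset (List ℕ → ℕ)}
    (hF : ∀ S ∈ F, IsShape h κ S)
    (hF' : ∀ N : List ℕ → ℕ, (∀ r, h (N r) ≠ 0) → 0 < N [] → κ < (offshootVerts N).ncard →
        ∃ S ∈ F, ∀ r, ¬ [0] <+: r → S r ≤ N r)
    {i k : ℕ} (hk : κ < k) {A : Set (AbsentFoliage i)} (hA : MeasurableSet A) (u : ℝ)
    {a : List ℕ} (hai : i ≤ a.length) (j : ℕ) (t : List ℕ) :
    gwLaw h ν (spineEvent κ i a j t ∩ largeOffshootEvent κ i k A u) ≤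
      ∫⁻ K, ∑ S ∈ F, {L : List ℕ → ℕ | j < L a}.indicator 1 K *
        ((sizeEvent a k).indicator 1 K * biasLaw ν {b | gw (modify a S K) b ∈
          spineEvent κ i a 0 t ∩ foliageEvent κ i A k u}) ∂offspringLaw h := by
  have hB : MeasurableSet (spineEvent κ i a 0 t ∩ foliageEvent κ i A k u) :=
    (measurableSet_spineEvent κ i a 0 t).inter (measurableSet_foliageEvent hA _ u)
  have hE : MeasurableSet (spineEvent κ i a j t ∩ largeOffshootEvent κ i k A u) :=
    (measurableSet_spineEvent κ i a j t).inter
      ((measurableSet_foliageEvent hA _ u).inter (measurableSet_card_offshoot κ i k))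
  have hmeas : Measurable fun K : List ℕ → ℕ =>
      ∑ S ∈ F, {L : List ℕ → ℕ | j < L a}.indicator (1 : (List ℕ → ℕ) → ℝ≥0∞) K *
        ((sizeEvent a k).indicator 1 K * biasLaw ν {b | gw (modify a S K) b ∈
          spineEvent κ i a 0 t ∩ foliageEvent κ i A k u}) := by
    refine Finset.measurable_sum _ fun S _ => Measurable.mul ?_ (Measurable.mul ?_ ?_)
    · exact measurable_one.indicator (measurableSet_lt measurable_const (measurable_pi_apply a))
    · exact measurable_one.indicator (measurableSet_sizeEvent a (by omega))
    · exact (measurable_biasLaw_gw_mem ν hB).comp (measurable_modify a S)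
  rw [gwLaw_apply h ν hE]
  conv_rhs => rw [offspringLaw, ← infinitePi_map_comp_injective h.toMeasure (swapAt_injective a j)]
  rw [lintegral_map hmeas (measurable_comp_label _)]
  refine lintegral_mono_ae ?_
  filter_upwards [ae_offspring_ne_zero h] with K hK
  exact biasLaw_le_sum_shapes hq hν hF hF' hk hA u hai j t hK

/-- The event for the pruned tree no longer mentions `j`, so summation over `j` only counts the
children of `a`, at most `k` of them. The size of the offshoot is independent of the modified tree,
and `shapeProb_mul_le` returns to the original law. -/
theorem tsum_gwLaw_spineEvent_le {h : PMF ℕ} {ν : Measure ℝ} [IsProbabilityMeasure ν] {q Q : ℝ}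
    (hq : 1 < q) (hν : ν (Set.Icc q Q)ᶜ = 0) {κ : ℕ} {F : Finset (List ℕ → ℕ)}
    (hF : ∀ S ∈ F, IsShape h κ S)
    (hF' : ∀ N : List ℕ → ℕ, (∀ r, h (N r) ≠ 0) → 0 < N [] → κ < (offshootVerts N).ncard →
        ∃ S ∈ F, ∀ r, ¬ [0] <+: r → S r ≤ N r)
    {i k : ℕ} (hk : κ < k) {A : Set (AbsentFoliage i)} (hA : MeasurableSet A) (u : ℝ)
    {a : List ℕ} (hai : i ≤ a.length) (t : List ℕ) :
    ∑' j, gwLaw h ν (spineEvent κ i a j t ∩ largeOffshootEvent κ i k A u) ≤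
      (∑ S ∈ F, (shapeProb h S)⁻¹) * (k * offspringLaw h (sizeEvent a k) *
        gwLaw h ν (spineEvent κ i a 0 t ∩ foliageEvent κ i A k u)) := by
  have hB : MeasurableSet (spineEvent κ i a 0 t ∩ foliageEvent κ i A k u) :=
    (measurableSet_spineEvent κ i a 0 t).inter (measurableSet_foliageEvent hA _ u)
  have hk0 : 0 < k := by omega
  set G : (List ℕ → ℕ) → (List ℕ → ℕ) → ℝ≥0∞ := fun S K => (sizeEvent a k).indicator 1 K *
    biasLaw ν {b | gw (modify a S K) b ∈ spineEvent κ i a 0 t ∩ foliageEvent κ i A k u} with hG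
  have hGm : ∀ S, Measurable (G S) := fun S =>
    (measurable_one.indicator (measurableSet_sizeEvent a hk0)).mul
      ((measurable_biasLaw_gw_mem ν hB).comp (measurable_modify a S))
  have hIm : ∀ j, Measurable ({L : List ℕ → ℕ | j < L a}.indicator (1 : (List ℕ → ℕ) → ℝ≥0∞)) :=
    fun j => measurable_one.indicator (measurableSet_lt measurable_const (measurable_pi_apply a))
  have hcount : ∀ S K, ∑' j, {L : List ℕ → ℕ | j < L a}.indicator 1 K * G S K ≤ k * G S K := by
    intro S K
    rw [ENNReal.tsum_mul_right]
    by_cases hK : K ∈ sizeEvent a k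
    · refine mul_le_mul_left ?_ _
      have h1 : ∑' j, {L : List ℕ → ℕ | j < L a}.indicator (1 : (List ℕ → ℕ) → ℝ≥0∞) K = K a := by
        rw [tsum_eq_sum (s := Finset.range (K a))]
        · rw [Finset.sum_congr rfl (g := fun _ => 1)]
          · simp
          · intro j hj
            exact Set.indicator_of_mem (s := {L : List ℕ → ℕ | j < L a}) (Finset.mem_range.1 hj) _
        · intro j hj
          exact Set.indicator_of_notMem (s := {L : List ℕ → ℕ | j < L a})
            (fun hj' => hj (Finset.mem_range.2 hj')) _
      rw [h1, Nat.cast_le]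
      have := root_le_ncard_offshootVerts (Set.finite_of_ncard_pos (hK.1.symm ▸ hk0))
      rw [hK.1] at this
      simpa using this
    · simp [hG, hK]
  calc ∑' j, gwLaw h ν (spineEvent κ i a j t ∩ largeOffshootEvent κ i k A u)
      ≤ ∑' j, ∫⁻ K, ∑ S ∈ F, {L : List ℕ → ℕ | j < L a}.indicator 1 K * G S K ∂offspringLaw h :=
        ENNReal.tsum_le_tsum fun j => gwLaw_spineEvent_le hq hν hF hF' hk hA u hai j t
    _ = ∫⁻ K, ∑ S ∈ F, ∑' j, {L : List ℕ → ℕ | j < L a}.indicator 1 K * G S K ∂offspringLaw h := by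
        have hm : ∀ j, Measurable fun K =>
            ∑ S ∈ F, {L : List ℕ → ℕ | j < L a}.indicator 1 K * G S K := fun j =>
          Finset.measurable_sum _ fun S _ => (hIm j).mul (hGm S)
        rw [← lintegral_tsum fun j => (hm j).aemeasurable]
        refine lintegral_congr fun K => ?_
        exact Summable.tsum_finsetSum fun _ _ => ENNReal.summable
    _ ≤ ∫⁻ K, ∑ S ∈ F, k * G S K ∂offspringLaw h :=
        lintegral_mono fun K => Finset.sum_le_sum fun S _ => hcount S K
    _ = ∑ S ∈ F, k * ∫⁻ K, G S K ∂offspringLaw h := by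
        rw [lintegral_finsetSum _ fun S _ => (hGm S).const_mul _]
        exact Finset.sum_congr rfl fun S _ => lintegral_const_mul _ (hGm S)
    _ ≤ ∑ S ∈ F, (shapeProb h S)⁻¹ * (k * offspringLaw h (sizeEvent a k) *
        gwLaw h ν (spineEvent κ i a 0 t ∩ foliageEvent κ i A k u)) := by
        refine Finset.sum_le_sum fun S hS => ?_
        rw [hG, lintegral_sizeEvent_mul h ν S a hk0 hB, ← mul_assoc, mul_left_comm]
        refine mul_le_mul_right ?_ _
        rw [mul_comm, ← div_eq_mul_inv, ENNReal.le_div_iff_mul_le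
          (Or.inl (hF S hS).shapeProb_ne_zero) (Or.inl (measure_ne_top _ _)), mul_comm]
        exact shapeProb_mul_le (hF S hS) a hB
    _ = _ := by rw [Finset.sum_mul]

/-- It remains to sum over the position `(a, t)` of the spine. The events after pruning are
disjoint, because `v_max` and the first branch point determine `a` and `t`. -/
theorem exists_gwLaw_largeOffshootEvent_le {h : PMF ℕ} {ν : Measure ℝ} [IsProbabilityMeasure ν]
    {q Q : ℝ} (hq : 1 < q) (hν : ν (Set.Icc q Q)ᶜ = 0) {κ : ℕ} (hκ0 : 0 < κ) (h0 : h 0 ≠ 0)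
    (hκ : h κ ≠ 0) (hmin : ∀ l, 0 < l → h l ≠ 0 → κ ≤ l) {ρ : ℝ≥0∞}
    (hρ : ∀ k : ℕ, 0 < k →
      offspringLaw h {K | (offshootVerts K).ncard = k ∧ 0 < K []} ≤ ρ ^ k) :
    ∃ C : ℝ≥0∞, C ≠ ∞ ∧ ∀ (i k : ℕ), κ < k → ∀ A : Set (AbsentFoliage i), MeasurableSet A →
      (∀ f ∈ A, i < f.1) → ∀ u : ℝ,
        gwLaw h ν (largeOffshootEvent κ i k A u) ≤
          C * (k * ρ ^ k) * gwLaw h ν (foliageEvent κ i A k u) := by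
  obtain ⟨F, hF, hF'⟩ := exists_shapes hκ0 h0 hκ hmin
  refine ⟨∑ S ∈ F, (shapeProb h S)⁻¹, ?_, fun i k hk A hA hAi u => ?_⟩
  · exact ENNReal.sum_ne_top.2 fun S hS => ENNReal.inv_ne_top.2 (hF S hS).shapeProb_ne_zero
  have hk0 : 0 < k := by omega
  let I := {a : List ℕ // i ≤ a.length} × List ℕ
  have hsub : largeOffshootEvent κ i k A u ⊆
      ⋃ x : I, ⋃ j : ℕ, spineEvent κ i x.1 j x.2 ∩ largeOffshootEvent κ i k A u := by
    intro T hT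
    have hs : i < T.vmax.length - T.fbpDepth κ := hAi _ hT.1.1
    have hlt : T.fbpDepth κ + i < T.vmax.length := by omega
    have hlen : (T.vmax.take (T.fbpDepth κ + i)).length = T.fbpDepth κ + i := by
      rw [List.length_take]; omega
    refine Set.mem_iUnion.2 ⟨(⟨T.vmax.take (T.fbpDepth κ + i), by omega⟩,
      T.vmax.drop (T.fbpDepth κ + i + 1)), Set.mem_iUnion.2
      ⟨T.vmax[T.fbpDepth κ + i], ⟨?_, ?_⟩, hT⟩⟩
    · rw [List.getElem_cons_drop, List.take_append_drop]
    · dsimp only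
      omega
  have hdisj : Pairwise (Function.onFun Disjoint fun x : I =>
      spineEvent κ i x.1 0 x.2 ∩ foliageEvent κ i A k u) := by
    rintro ⟨⟨a, ha⟩, t⟩ ⟨⟨a', ha'⟩, t'⟩ hne
    refine Set.disjoint_left.2 fun T hT hT' => hne ?_
    obtain ⟨⟨h1, h2⟩, -⟩ := hT
    obtain ⟨⟨h3, h4⟩, -⟩ := hT'
    dsimp only at h1 h2 h3 h4
    have hl : a.length = a'.length := by omega
    obtain ⟨rfl, h5⟩ := List.append_inj (h1.symm.trans h3) hl
    obtain rfl : t = t' := by simpa using h5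
    rfl
  calc gwLaw h ν (largeOffshootEvent κ i k A u)
      ≤ ∑' x : I, ∑' j : ℕ, gwLaw h ν (spineEvent κ i x.1 j x.2 ∩ largeOffshootEvent κ i k A u) := by
        refine (measure_mono hsub).trans ((measure_iUnion_le _).trans ?_)
        exact ENNReal.tsum_le_tsum fun x => measure_iUnion_le _
    _ ≤ ∑' x : I, (∑ S ∈ F, (shapeProb h S)⁻¹) * (k * ρ ^ k) *
          gwLaw h ν (spineEvent κ i x.1 0 x.2 ∩ foliageEvent κ i A k u) := by
        refine ENNReal.tsum_le_tsum fun x =>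
          (tsum_gwLaw_spineEvent_le hq hν hF hF' hk hA u x.1.2 x.2).trans ?_
        rw [offspringLaw_sizeEvent h _ hk0]
        exact (mul_le_mul_right (mul_le_mul_left (mul_le_mul_right (hρ k hk0) _) _) _).trans
          (mul_assoc _ _ _).ge
    _ = (∑ S ∈ F, (shapeProb h S)⁻¹) * (k * ρ ^ k) *
          gwLaw h ν (⋃ x : I, spineEvent κ i x.1 0 x.2 ∩ foliageEvent κ i A k u) := by
        rw [ENNReal.tsum_mul_left, measure_iUnion hdisj fun x =>
          (measurableSet_spineEvent _ _ _ _ _).inter (measurableSet_foliageEvent hA _ u)]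
    _ ≤ _ := by
        gcongr
        exact Set.iUnion_subset fun x => Set.inter_subset_right

/-! ### Conditioning on the foliage -/

theorem measurableSet_lt_length (i : ℕ) : MeasurableSet {f : AbsentFoliage i | i < f.1} := by
  refine MeasurableSpace.measurableSet_iInf.2 fun s => ?_
  exact (MeasurableSet.const (i < s) :
    MeasurableSet {_a : (Fin s → ℝ) × ({j : Fin s // (j : ℕ) ≠ i} → UTree) | i < s})

instance (h : PMF ℕ) (ν : Measure ℝ) [IsProbabilityMeasure ν] (i : ℕ) :
    IsMarkovKernel (absentLaw h ν i) := by
  rw [absentLaw]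
  infer_instance

theorem setLIntegral_absentLaw (h : PMF ℕ) (ν : Measure ℝ) [IsProbabilityMeasure ν] (i : ℕ)
    {A : Set (AbsentFoliage i)} (hA : MeasurableSet A) {S : Set WTree} (hS : MeasurableSet S) :
    ∫⁻ f in A, absentLaw h ν i f S ∂(gwLaw h ν).map (absentFoliage (minOffspring h) i) =
      gwLaw h ν (absentFoliage (minOffspring h) i ⁻¹' A ∩ S) := by
  rw [← Measure.compProd_apply_prod hA hS, absentLaw, compProd_map_condDistrib aemeasurable_id,
    Measure.map_apply ((measurable_absentFoliage _ i).prodMk measurable_id) (hA.prod hS)]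
  rfl

/-- The integrals of the two sides over a set of foliages are unconditional probabilities, so an
inequality for all such sets yields the pointwise one almost everywhere. -/
theorem ae_absentLaw_le {h : PMF ℕ} {ν : Measure ℝ} [IsProbabilityMeasure ν] {i : ℕ}
    {S S' : Set WTree} (hS : MeasurableSet S) (hS' : MeasurableSet S') {c : ℝ≥0∞}
    (H : ∀ A : Set (AbsentFoliage i), MeasurableSet A → (∀ f ∈ A, i < f.1) →
      gwLaw h ν (absentFoliage (minOffspring h) i ⁻¹' A ∩ S) ≤
        c * gwLaw h ν (absentFoliage (minOffspring h) i ⁻¹' A ∩ S')) :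
    ∀ᵐ f ∂(gwLaw h ν).map (absentFoliage (minOffspring h) i),
      i < f.1 → absentLaw h ν i f S ≤ c * absentLaw h ν i f S' := by
  have hprob : IsProbabilityMeasure ((gwLaw h ν).map (absentFoliage (minOffspring h) i)) :=
    Measure.isProbabilityMeasure_map (measurable_absentFoliage _ i).aemeasurable
  have hm := Kernel.measurable_coe (absentLaw h ν i) hS
  have hm' := Kernel.measurable_coe (absentLaw h ν i) hS'
  have hD := measurableSet_lt_length i
  refine (ae_restrict_iff' hD).1 ?_
  refine ae_le_of_forall_setLIntegral_le_of_sigmaFinite hm fun A hA _ => ?_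
  rw [Measure.restrict_restrict hA, lintegral_const_mul _ hm',
    setLIntegral_absentLaw h ν i (hA.inter hD) hS, setLIntegral_absentLaw h ν i (hA.inter hD) hS']
  exact H _ (hA.inter hD) fun f hf => hf.2

theorem ae_absentLaw_ne_zero {h : PMF ℕ} {ν : Measure ℝ} [IsProbabilityMeasure ν] {i : ℕ}
    {S : Set WTree} (hS : MeasurableSet S)
    (H : ∀ A : Set (AbsentFoliage i), MeasurableSet A → (∀ f ∈ A, i < f.1) →
      gwLaw h ν (absentFoliage (minOffspring h) i ⁻¹' A ∩ S) = 0 →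
        gwLaw h ν (absentFoliage (minOffspring h) i ⁻¹' A) = 0) :
    ∀ᵐ f ∂(gwLaw h ν).map (absentFoliage (minOffspring h) i),
      i < f.1 → absentLaw h ν i f S ≠ 0 := by
  have hm := Kernel.measurable_coe (absentLaw h ν i) hS
  have hA : MeasurableSet ({f : AbsentFoliage i | i < f.1} ∩ {f | absentLaw h ν i f S = 0}) :=
    (measurableSet_lt_length i).inter (hm (measurableSet_singleton 0))
  have hz := H _ hA (fun f hf => hf.1) <| by
    rw [← setLIntegral_absentLaw h ν i hA hS, setLIntegral_congr_fun hA fun f hf => hf.2]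
    simp
  rw [← Measure.map_apply (measurable_absentFoliage _ i) hA] at hz
  rw [ae_iff]
  refine measure_mono_null (fun f hf => ?_) hz
  simpa using hf

/-! ### The main estimates -/

theorem ae_one_le_totalWeight {h : PMF ℕ} {ν : Measure ℝ} [IsProbabilityMeasure ν] {q Q : ℝ}
    (hq : 1 < q) (hν : ν (Set.Icc q Q)ᶜ = 0) : ∀ᵐ T ∂gwLaw h ν, 1 ≤ T.totalWeight := by
  rw [gwLaw_eq_map, ae_map_iff measurable_gw.aemeasurable
    (measurableSet_le measurable_const measurable_totalWeight)]
  filter_upwards [Measure.quasiMeasurePreserving_snd.ae (ae_le_bias hν)] with p hp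
  exact WTree.one_le_totalWeight fun u => by rw [gw_bias]; exact hq.trans_le (hp u)

/-- Iterated prolongation: a factor `q ^ n` on the weight is absorbed by the threshold, and `H`
holds for every threshold. -/
theorem pow_mul_gwLaw_foliageEvent_le {h : PMF ℕ} {ν : Measure ℝ} [IsProbabilityMeasure ν] {q : ℝ}
    (hq : 1 < q) {κ i : ℕ} {p : ℝ≥0∞} {A : Set (AbsentFoliage i)}
    (H : ∀ u : ℝ, p * gwLaw h ν (foliageEvent κ i A q u) ≤ gwLaw h ν (foliageEvent κ i A 1 u))
    (n : ℕ) (u : ℝ) :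
    p ^ n * gwLaw h ν (foliageEvent κ i A (q ^ n) u) ≤ gwLaw h ν (foliageEvent κ i A 1 u) := by
  induction n with
  | zero => simp
  | succ n ih =>
    have hqn : 0 < q ^ n := pow_pos (zero_lt_one.trans hq) n
    have h1 : foliageEvent κ i A (q ^ (n + 1)) u = foliageEvent κ i A q (u / q ^ n) := by
      ext T
      simp only [foliageEvent, Set.mem_ofPred_eq, div_lt_iff₀ hqn, pow_succ]
      ring_nf
    have h2 : foliageEvent κ i A (q ^ n) u = foliageEvent κ i A 1 (u / q ^ n) := by
      ext T
      simp only [foliageEvent, Set.mem_ofPred_eq, div_lt_iff₀ hqn]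
      ring_nf
    rw [h1, pow_succ, mul_assoc]
    rw [h2] at ih
    exact (mul_le_mul_right (H _) _).trans ih

theorem gwLaw_foliageEvent_mono {h : PMF ℕ} {ν : Measure ℝ} [IsProbabilityMeasure ν] {q Q : ℝ}
    (hq : 1 < q) (hν : ν (Set.Icc q Q)ᶜ = 0) {κ i : ℕ} {A : Set (AbsentFoliage i)} {x y : ℝ}
    (hxy : x ≤ y) (u : ℝ) :
    gwLaw h ν (foliageEvent κ i A x u) ≤ gwLaw h ν (foliageEvent κ i A y u) := by
  refine measure_mono_ae ?_
  filter_upwards [ae_one_le_totalWeight hq hν] with T hT hmem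
  exact ⟨hmem.1, hmem.2.trans_le (mul_le_mul_of_nonneg_right hxy (zero_le_one.trans hT))⟩

/-- Once `q ^ n` exceeds `u`, the condition on the weight holds automatically, since the total
weight is at least `1`. -/
theorem gwLaw_foliage_eq_zero {h : PMF ℕ} {ν : Measure ℝ} [IsProbabilityMeasure ν] {q Q : ℝ}
    (hq : 1 < q) (hν : ν (Set.Icc q Q)ᶜ = 0) {κ i : ℕ} {p : ℝ≥0∞} (hp : p ≠ 0)
    {A : Set (AbsentFoliage i)}
    (H : ∀ u : ℝ, p * gwLaw h ν (foliageEvent κ i A q u) ≤ gwLaw h ν (foliageEvent κ i A 1 u))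
    {u : ℝ} (h0 : gwLaw h ν (foliageEvent κ i A 1 u) = 0) :
    gwLaw h ν (absentFoliage κ i ⁻¹' A) = 0 := by
  obtain ⟨n, hn⟩ := pow_unbounded_of_one_lt u hq
  have h1 := pow_mul_gwLaw_foliageEvent_le hq H n u
  rw [h0, nonpos_iff_eq_zero, mul_eq_zero, or_iff_right (pow_ne_zero n hp)] at h1
  refine le_antisymm (le_trans (measure_mono_ae ?_) h1.le) zero_le
  filter_upwards [ae_one_le_totalWeight hq hν] with T hT hmem
  exact ⟨hmem, hn.trans_le (le_mul_of_one_le_right (pow_pos (zero_lt_one.trans hq) n).le hT)⟩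

-- The choice `n = k / N` with a large constant `N` serves both purposes: `q ^ (k / N)` still
-- outgrows `k`, and `p ^ n` uses at most half of the available exponential rate.
open Filter Topology in
theorem exists_exponential_rate {q : ℝ} (hq : 1 < q) {ρ C p : ℝ≥0∞} (hρ : ρ < 1) (hC : C ≠ ∞)
    (hp : p ≠ 0) (hp1 : p ≤ 1) :
    ∃ c : ℝ, 0 < c ∧ ∃ k₀ : ℕ, ∀ k : ℕ, k₀ ≤ k → ∃ n : ℕ, (k : ℝ) ≤ q ^ n ∧
      C * (k * ρ ^ k) ≤ ENNReal.ofReal (Real.exp (-(c * k))) * p ^ n := by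
  have hptop : p ≠ ∞ := (hp1.trans_lt ENNReal.one_lt_top).ne
  set P := p.toReal with hP
  have hP0 : 0 < P := ENNReal.toReal_pos hp hptop
  set r := ρ.toReal with hr
  have hr0 : 0 ≤ r := ENNReal.toReal_nonneg
  have hr1 : r < 1 := by
    simpa using (ENNReal.toReal_lt_toReal hρ.ne_top ENNReal.one_ne_top).2 hρ
  set D := C.toReal with hD
  have hD0 : 0 ≤ D := ENNReal.toReal_nonneg
  -- Passing from `r` to the larger `σ` absorbs the factor `C * k` for large `k`.
  obtain ⟨σ, hσr, hσ1⟩ := exists_between hr1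
  have hσ0 : 0 < σ := hr0.trans_lt hσr
  set L := -Real.log σ with hL
  have hL0 : 0 < L := neg_pos.2 (Real.log_neg hσ0 hσ1)
  set M := -Real.log P with hM
  have hM0 : 0 ≤ M := neg_nonneg.2 (Real.log_nonpos hP0.le
    (by simpa using ENNReal.toReal_mono ENNReal.one_ne_top hp1))
  -- This makes `M * (k / N) ≤ L * k / 2`.
  obtain ⟨N, hN⟩ := exists_nat_gt (max (2 * M / L) 0)
  have hN0 : (0 : ℝ) < N := (le_max_right _ _).trans_lt hN
  have hN0' : 0 < N := by exact_mod_cast hN0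
  have hNM : 2 * M ≤ N * L := by
    rw [← div_le_iff₀ hL0]
    exact ((le_max_left _ _).trans_lt hN).le
  have hlim1 : Tendsto (fun k : ℕ => D * (k * (r / σ) ^ k)) atTop (𝓝 (D * 0)) :=
    (tendsto_self_mul_const_pow_of_lt_one (by positivity) ((div_lt_one hσ0).2 hσr)).const_mul D
  rw [mul_zero] at hlim1
  have hlim2 : Tendsto (fun m : ℕ => (m : ℝ) ^ 1 / q ^ m) atTop (𝓝 0) :=
    tendsto_pow_const_div_const_pow_of_one_lt 1 hq
  obtain ⟨k₁, hk₁⟩ := eventually_atTop.1 (hlim1.eventually (gt_mem_nhds one_pos))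
  obtain ⟨m₁, hm₁⟩ := eventually_atTop.1
    (hlim2.eventually (gt_mem_nhds (by positivity : (0 : ℝ) < 1 / (2 * N))))
  refine ⟨L / 2, half_pos hL0, max k₁ (N * (m₁ + 1)), fun k hk => ⟨k / N, ?_, ?_⟩⟩
  · have hm : m₁ + 1 ≤ k / N :=
      (Nat.le_div_iff_mul_le hN0').2 (by rw [mul_comm]; exact (le_max_right _ _).trans hk)
    have h1 := hm₁ (k / N) (by omega)
    have hqm : 0 < q ^ (k / N) := pow_pos (zero_lt_one.trans hq) _
    rw [pow_one, div_lt_div_iff₀ hqm (by positivity), one_mul] at h1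
    have h2 : k < N * (k / N + 1) := Nat.lt_mul_div_succ k hN0'
    have h3 : (k : ℝ) ≤ N * (((k / N : ℕ) : ℝ) + 1) := by exact_mod_cast h2.le
    have h4 : (1 : ℝ) ≤ ((k / N : ℕ) : ℝ) := by exact_mod_cast (by omega : 1 ≤ k / N)
    -- With `m = k / N`: `k ≤ N * (m + 1) ≤ 2 * N * m ≤ q ^ m`.
    nlinarith
  · have h1 := hk₁ k ((le_max_left _ _).trans hk)
    have h2 : D * (k * r ^ k) ≤ σ ^ k := by
      rw [div_pow, mul_div_assoc', mul_div_assoc', div_lt_one (pow_pos hσ0 k)] at h1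
      exact h1.le
    have h3 : σ ^ k ≤ Real.exp (-(L / 2 * k)) * P ^ (k / N) := by
      have e1 : σ ^ k = Real.exp (-(L * k)) := by
        rw [← Real.exp_log (pow_pos hσ0 k), Real.log_pow, hL]
        ring_nf
      have e2 : P ^ (k / N) = Real.exp (-(M * ((k / N : ℕ) : ℝ))) := by
        rw [← Real.exp_log (pow_pos hP0 (k / N)), Real.log_pow, hM]
        ring_nf
      rw [e1, e2, ← Real.exp_add, Real.exp_le_exp]
      have h4 : (N : ℝ) * ((k / N : ℕ) : ℝ) ≤ k := by exact_mod_cast Nat.mul_div_le k N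
      have h5 := mul_le_mul_of_nonneg_right hNM (Nat.cast_nonneg (α := ℝ) (k / N))
      have h6 := mul_le_mul_of_nonneg_left h4 hL0.le
      linarith
    have hC' : C = ENNReal.ofReal D := (ENNReal.ofReal_toReal hC).symm
    have hρ' : ρ = ENNReal.ofReal r := (ENNReal.ofReal_toReal hρ.ne_top).symm
    have hp' : p = ENNReal.ofReal P := (ENNReal.ofReal_toReal hptop).symm
    rw [hC', hρ', hp', ← ENNReal.ofReal_pow hr0, ← ENNReal.ofReal_pow hP0.le,
      ← ENNReal.ofReal_natCast, ← ENNReal.ofReal_mul (by positivity), ← ENNReal.ofReal_mul hD0,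
      ← ENNReal.ofReal_mul (Real.exp_pos _).le]
    exact ENNReal.ofReal_le_ofReal (h2.trans h3)

theorem offspring_zero_ne_zero {h : PMF ℕ} (hmean : ∑' k : ℕ, (k : ℝ≥0∞) * h k < 1) : h 0 ≠ 0 := by
  intro h0
  refine hmean.not_ge ?_
  rw [← h.tsum_coe]
  refine ENNReal.tsum_le_tsum fun k => ?_
  cases k with
  | zero => simp [h0]
  | succ k =>
    exact le_mul_of_one_le_left zero_le (by exact_mod_cast Nat.succ_pos k)

theorem ae_not_lt_length {h : PMF ℕ} (ν : Measure ℝ) [IsProbabilityMeasure ν]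
    (hdeg : ∀ l, 0 < l → h l = 0) (κ i : ℕ) :
    ∀ᵐ f ∂(gwLaw h ν).map (absentFoliage κ i), ¬ i < f.1 := by
  have hm : MeasurableSet {f : AbsentFoliage i | ¬ i < f.1} := (measurableSet_lt_length i).compl
  rw [ae_map_iff (measurable_absentFoliage _ i).aemeasurable hm,
    gwLaw_eq_map]
  have hm' : MeasurableSet {T : WTree | ¬ i < (absentFoliage κ i T).1} :=
    measurable_absentFoliage κ i hm
  rw [ae_map_iff measurable_gw.aemeasurable hm']
  filter_upwards [Measure.quasiMeasurePreserving_fst.ae (ae_offspring_ne_zero h)] with p hp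
  intro hs
  change i < (gw p.1 p.2).spineLength κ at hs
  have hfin := finite_of_spineLength_pos (Nat.zero_le i |>.trans_lt hs)
  have hv := (mem_gw_verts hfin).1 (gw p.1 p.2).vmax_mem
  have hzero : ∀ u, p.1 u = 0 := fun u => by
    by_contra hu
    exact hp u (hdeg _ (Nat.pos_of_ne_zero hu))
  rw [WTree.spineLength] at hs
  cases hvm : (gw p.1 p.2).vmax with
  | nil => simp [hvm] at hs
  | cons m u =>
    rw [hvm, cons_mem_gwVerts, hzero] at hv
    omega

/-- Rational thresholds suffice, which keeps the exceptional set of foliages null and independent of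
`u`: the event `ω > u` is the increasing union of the events `ω > r` over rational `r > u`. -/
theorem absentLaw_estimate {h : PMF ℕ} {ν : Measure ℝ} [IsProbabilityMeasure ν] {i : ℕ}
    {f : AbsentFoliage i} {C : Set WTree} {c : ℝ≥0∞}
    (H : ∀ r : ℚ, absentLaw h ν i f ({T | (r : ℝ) < T.totalWeight} ∩ C) ≤
      c * absentLaw h ν i f {T | (r : ℝ) < T.totalWeight}) (u : ℝ) :
    ProbabilityTheory.cond (absentLaw h ν i f) {T | u < T.totalWeight} C ≤ c := by
  have hm : MeasurableSet {T : WTree | u < T.totalWeight} :=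
    measurableSet_lt measurable_const measurable_totalWeight
  have hU : {T : WTree | u < T.totalWeight} ∩ C =
      ⋃ r : {r : ℚ // u < r}, {T | ((r : ℚ) : ℝ) < T.totalWeight} ∩ C := by
    ext T
    simp only [Set.mem_inter_iff, Set.mem_ofPred_eq, Set.mem_iUnion]
    constructor
    · rintro ⟨h1, h2⟩
      obtain ⟨r, hr1, hr2⟩ := exists_rat_btwn h1
      exact ⟨⟨r, hr1⟩, hr2, h2⟩
    · rintro ⟨r, h1, h2⟩
      exact ⟨r.2.trans h1, h2⟩
  have hdir : Directed (· ⊆ ·) fun r : {r : ℚ // u < r} =>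
      {T : WTree | ((r : ℚ) : ℝ) < T.totalWeight} ∩ C := by
    have hanti : ∀ r s : {r : ℚ // u < r}, r ≤ s →
        {T : WTree | ((s : ℚ) : ℝ) < T.totalWeight} ∩ C ⊆
          {T : WTree | ((r : ℚ) : ℝ) < T.totalWeight} ∩ C := fun r s hrs T hT =>
      ⟨(Rat.cast_le.2 (show (r : ℚ) ≤ s from hrs)).trans_lt
        (show ((s : ℚ) : ℝ) < T.totalWeight from hT.1), hT.2⟩
    intro r s
    exact ⟨min r s, hanti _ _ (min_le_left r s), hanti _ _ (min_le_right r s)⟩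
  rw [cond_apply hm, mul_comm, ← div_eq_mul_inv]
  refine ENNReal.div_le_of_le_mul ?_
  rw [hU, hdir.measure_iUnion]
  refine iSup_le fun r => (H r).trans (mul_le_mul_right (measure_mono fun T hT => ?_) _)
  exact r.2.trans hT

end WeightedGW

end

/-! ### Assembly of the estimates. -/

theorem mainTheorem7 (h : PMF ℕ) (ν : Measure ℝ) [IsProbabilityMeasure ν] (q Q : ℝ) (hq : 1 < q)
    (hν : ν (Set.Icc q Q)ᶜ = 0)
    (hmean : ∑' k : ℕ, (k : ℝ≥0∞) * h k < 1)
    (htail : ∃ c : ℝ, 0 < c ∧ ∀ k : ℕ, ∑' l : ℕ, h (k + l) ≤ ENNReal.ofReal (Real.exp (-(c * k))))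
    (hdeg : h 1 ≠ 0 ∨ ∀ x : ℝ, ν ≠ Measure.dirac x) :
    ∃ c : ℝ, 0 < c ∧ ∃ k₀ : ℕ, ∀ i : ℕ,
      ∀ᵐ f ∂((WeightedGW.gwLaw h ν).map
          (WeightedGW.absentFoliage (WeightedGW.minOffspring h) i)),
        i < f.1 → ∀ u : ℝ, 0 < u →
          0 < WeightedGW.absentLaw h ν i f {T | u < T.totalWeight} ∧
          ∀ k : ℕ, k₀ ≤ k →
            ProbabilityTheory.cond (WeightedGW.absentLaw h ν i f) {T | u < T.totalWeight}
                {T | (T.offshoot (WeightedGW.minOffspring h) i).verts.card = k} ≤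
              ENNReal.ofReal (Real.exp (-(c * k))) := by
  open WeightedGW in
  classical
  have h0 := offspring_zero_ne_zero hmean
  by_cases hex : ∃ l, 1 ≤ l ∧ h l ≠ 0
  swap
  -- Here the tree is almost surely its root, so there is no spine and the default value `0` of
  -- `minOffspring` does no harm.
  · refine ⟨1, one_pos, 0, fun i => ?_⟩
    have hz : ∀ l, 0 < l → h l = 0 := fun l hl => by
      by_contra hne
      exact hex ⟨l, hl, hne⟩
    filter_upwards [ae_not_lt_length ν hz (minOffspring h) i] with f hf hlt
    exact absurd hlt hf
  obtain ⟨hκ0, hκ⟩ : 1 ≤ minOffspring h ∧ h (minOffspring h) ≠ 0 := Nat.sInf_mem hex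
  have hmin : ∀ l, 0 < l → h l ≠ 0 → minOffspring h ≤ l := fun l hl hne => Nat.sInf_le ⟨hl, hne⟩
  have hdeg' : minOffspring h = 1 ∨ ∀ x : ℝ, ν ≠ Measure.dirac x :=
    hdeg.imp_left fun h1 => le_antisymm (hmin 1 one_pos h1) hκ0
  obtain ⟨ρ, hρ1, hρ⟩ := exists_offspringLaw_ncard_le hmean htail
  obtain ⟨C, hC, hprune⟩ := exists_gwLaw_largeOffshootEvent_le hq hν hκ0 h0 hκ hmin hρ
  obtain ⟨p, hp, hprol⟩ := gwLaw_foliageEvent_ge hq hν hκ0 h0 hκ hdeg'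
  have hprol' : ∀ (i : ℕ) (A : Set (AbsentFoliage i)), MeasurableSet A → (∀ f ∈ A, i < f.1) →
      ∀ u : ℝ, min p 1 * gwLaw h ν (foliageEvent (minOffspring h) i A q u) ≤
        gwLaw h ν (foliageEvent (minOffspring h) i A 1 u) := fun i A hA hAi u =>
    (mul_le_mul_left (min_le_left _ _) _).trans (hprol i A hA hAi u)
  have hp' : min p 1 ≠ 0 := (lt_min (pos_iff_ne_zero.2 hp) one_pos).ne'
  obtain ⟨c, hc, k₀, hrate⟩ := exists_exponential_rate hq hρ1 hC hp' (min_le_right _ _)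
  -- Pruning requires `κ < k`, whence the second entry of the maximum.
  refine ⟨c, hc, max k₀ (minOffspring h + 1), fun i => ?_⟩
  have hS : ∀ u : ℝ, MeasurableSet {T : WTree | u < T.totalWeight} := fun u =>
    measurableSet_lt measurable_const measurable_totalWeight
  have hfol : ∀ (A : Set (AbsentFoliage i)) (u : ℝ),
      absentFoliage (minOffspring h) i ⁻¹' A ∩ {T | u < T.totalWeight} =
        foliageEvent (minOffspring h) i A 1 u := fun A u => by
    ext T
    simp [foliageEvent]
  have hpos : ∀ᵐ f ∂(gwLaw h ν).map (absentFoliage (minOffspring h) i), ∀ r : ℚ,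
      i < f.1 → absentLaw h ν i f {T | (r : ℝ) < T.totalWeight} ≠ 0 := by
    refine ae_all_iff.2 fun r => ae_absentLaw_ne_zero (hS _) fun A hA hAi hz => ?_
    rw [hfol] at hz
    exact gwLaw_foliage_eq_zero hq hν hp' (hprol' i A hA hAi) hz
  have hle : ∀ᵐ f ∂(gwLaw h ν).map (absentFoliage (minOffspring h) i), ∀ (r : ℚ) (k : ℕ),
      max k₀ (minOffspring h + 1) ≤ k → i < f.1 →
        absentLaw h ν i f ({T | (r : ℝ) < T.totalWeight} ∩
          {T | (T.offshoot (minOffspring h) i).verts.card = k}) ≤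
        ENNReal.ofReal (Real.exp (-(c * k))) *
          absentLaw h ν i f {T | (r : ℝ) < T.totalWeight} := by
    refine ae_all_iff.2 fun r => ae_all_iff.2 fun k => ?_
    by_cases hk : max k₀ (minOffspring h + 1) ≤ k
    swap
    · exact Filter.Eventually.of_forall fun f hk' => absurd hk' hk
    refine (ae_absentLaw_le ((hS _).inter (measurableSet_card_offshoot _ i k)) (hS _)
      fun A hA hAi => ?_).mono fun f hf _ => hf
    obtain ⟨n, hn1, hn2⟩ := hrate k ((le_max_left _ _).trans hk)
    rw [← Set.inter_assoc, hfol]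
    calc gwLaw h ν (largeOffshootEvent (minOffspring h) i k A r)
        ≤ C * (k * ρ ^ k) * gwLaw h ν (foliageEvent (minOffspring h) i A k r) :=
          hprune i k ((le_max_right _ _).trans hk) A hA hAi r
      _ ≤ ENNReal.ofReal (Real.exp (-(c * k))) * min p 1 ^ n *
          gwLaw h ν (foliageEvent (minOffspring h) i A (q ^ n) r) :=
          mul_le_mul' hn2 (gwLaw_foliageEvent_mono hq hν hn1 r)
      _ ≤ ENNReal.ofReal (Real.exp (-(c * k))) *
          gwLaw h ν (foliageEvent (minOffspring h) i A 1 r) := by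
          rw [mul_assoc]
          exact mul_le_mul_right
            (pow_mul_gwLaw_foliageEvent_le hq (hprol' i A hA hAi) n r) _
  filter_upwards [hpos, hle] with f hf1 hf2 hi u _
  refine ⟨?_, fun k hk => absentLaw_estimate (fun r => hf2 r k hk hi) u⟩
  obtain ⟨r, hr⟩ := exists_rat_gt u
  exact (pos_iff_ne_zero.2 (hf1 r hi)).trans_le (measure_mono fun T hT => hr.trans hT)
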